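/- Let $\mathcal{E}=\{x\in\mathbb{R} : |x|>1\}$. All functions are complex valued, and for an open set $U\subseteq\mathbb{R}$, $W^{1,2}(U)$ is the space of all $v\in L^2(U)$ with weak derivative $v'\in L^2(U)$, normed by $\|v\|_{W^{1,2}(U)}^2=\|v\|_{L^2(U)}^2+\|v'\|_{L^2(U)}^2$. For $f\in L^2(\mathbb{R})$ let $$(\mathcal{H}f)(x)=\frac1\pi\lim_{\varepsilon\to0+}\int_{|x-\tilde x|\ge\varepsilon}\frac{f(\tilde x)}{x-\tilde x}\,d\tilde x$$ (for almost every $x\in\mathbb{R}$) be its Hilbert transform, and for $u\in W^{1,2}(\mathbb{R})$ let $\Lambda_{\mathbb{H}}u=-\mathcal{H}u'$ be the Dirichlet-to-Neumann map of the upper half-plane. For $v:\mathcal{E}\to\mathbb{C}$ define $\eta(v)$ (almost everywhere) on $\mathbb{R}$ by $\eta(v)(x)=v(x)$ for $|x|>1$, $\eta(v)(x)=v(1/x)$ for $0<|x|<1$, and $\eta(v)(0)=0$. Let $V_0(\mathcal{E})$ be the space of those $v\in W^{1,2}(\mathcal{E})$ whose support is a compact subset of $\mathbb{R}$. For every $v\in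 V_0(\mathcal{E})$ one has $\eta(v)\in W^{1,2}(\mathbb{R})$, and the Dirichlet-to-Neumann map $\Lambda_\Omega$ of $\Omega=\{(x,y)\in\mathbb{R}^2: x^2+y^2>1,\ y>0\}$ is defined on $V_0(\mathcal{E})$ by $$(\Lambda_\Omega v)(x)=[\Lambda_{\mathbb{H}}(\eta(v))](x)\qquad\text{for almost every } x\in\mathcal{E}.$$ Then $\Lambda_\Omega$ extends, in a unique way, to a bounded linear operator, still denoted by $\Lambda_\Omega$, from $W^{1,2}(\mathcal{E})$ to $L^2(\mathcal{E})$. Moreover, for every $v\in W^{1,2}(\mathcal{E})$ and almost every $x\in\mathcal{E}$, the principal values defining $\mathcal{H}(g(v))$ at $x$ and at $1/x$ exist and $$(\Lambda_\Omega v)(x)=-(\mathcal{H}(g(v)))(x)-\frac1{x^2}(\mathcal{H}(g(v)))\left(\frac1x\right)-\frac{v(1)-v(-1)}{\pi x},$$ where $g(v)\in L^2(\mathbb{R})$ is the extension of $v'$ by zero outside $\mathcal{E}$, and $v(\pm1)$ are the values at $\pm1$ of the representative of $v$ that is continuous on $\{|x|\ge1\}$. -/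

import Mathlib

open MeasureTheory Filter Topology
open scoped ContDiff

noncomputable section

namespace FloatingDisk

/-- The free surface `ℰ = {x ∈ ℝ | |x| > 1}`. -/
def freeSurface : Set ℝ := {x | 1 < |x|}

/-- The space `L²(U)` of complex-valued functions, for `U ⊆ ℝ` with Lebesgue measure. -/
abbrev L2 (U : Set ℝ) : Type := Lp ℂ 2 ((volume : Measure ℝ).restrict U)

/-- `w` is the weak derivative of `v` on `U`: `∫_U v φ' = - ∫_U w φ` for all `φ ∈ C_c^∞(U)`. -/
def IsWeakDeriv (U : Set ℝ) (v w : L2 U) : Prop :=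
  ∀ φ : ℝ → ℂ, ContDiff ℝ ∞ φ → HasCompactSupport φ → tsupport φ ⊆ U →
    ∫ x in U, v x * deriv φ x = - ∫ x in U, w x * φ x

theorem integrable_mul_test {U : Set ℝ} (v : L2 U) {φ : ℝ → ℂ} (hφ : Continuous φ)
    (hc : HasCompactSupport φ) :
    Integrable (fun x => v x * φ x) ((volume : Measure ℝ).restrict U) :=
  (Lp.memLp v).integrable_mul (q := 2) (hφ.memLp_of_hasCompactSupport hc)

theorem IsWeakDeriv.add {U : Set ℝ} {v₁ w₁ v₂ w₂ : L2 U} (h₁ : IsWeakDeriv U v₁ w₁)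
    (h₂ : IsWeakDeriv U v₂ w₂) : IsWeakDeriv U (v₁ + v₂) (w₁ + w₂) := by
  intro φ hφ hc hs
  have hd : Continuous (deriv φ) := hφ.continuous_deriv (by simp)
  have e₁ : ∫ x in U, (v₁ + v₂ : L2 U) x * deriv φ x
      = (∫ x in U, v₁ x * deriv φ x) + ∫ x in U, v₂ x * deriv φ x := by
    rw [← integral_add (integrable_mul_test v₁ hd hc.deriv) (integrable_mul_test v₂ hd hc.deriv)]
    refine integral_congr_ae ?_
    filter_upwards [Lp.coeFn_add v₁ v₂] with x hx
    rw [hx, Pi.add_apply, add_mul]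
  have e₂ : ∫ x in U, (w₁ + w₂ : L2 U) x * φ x
      = (∫ x in U, w₁ x * φ x) + ∫ x in U, w₂ x * φ x := by
    rw [← integral_add (integrable_mul_test w₁ hφ.continuous hc)
      (integrable_mul_test w₂ hφ.continuous hc)]
    refine integral_congr_ae ?_
    filter_upwards [Lp.coeFn_add w₁ w₂] with x hx
    rw [hx, Pi.add_apply, add_mul]
  rw [e₁, e₂, h₁ φ hφ hc hs, h₂ φ hφ hc hs, neg_add]

theorem IsWeakDeriv.smul {U : Set ℝ} {v w : L2 U} (c : ℂ) (h : IsWeakDeriv U v w) :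
    IsWeakDeriv U (c • v) (c • w) := by
  intro φ hφ hc hs
  have e₁ : ∫ x in U, (c • v : L2 U) x * deriv φ x = c * ∫ x in U, v x * deriv φ x := by
    rw [← integral_const_mul]
    refine integral_congr_ae ?_
    filter_upwards [Lp.coeFn_smul c v] with x hx
    rw [hx, Pi.smul_apply, smul_eq_mul, mul_assoc]
  have e₂ : ∫ x in U, (c • w : L2 U) x * φ x = c * ∫ x in U, w x * φ x := by
    rw [← integral_const_mul]
    refine integral_congr_ae ?_
    filter_upwards [Lp.coeFn_smul c w] with x hx
    rw [hx, Pi.smul_apply, smul_eq_mul, mul_assoc]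
  rw [e₁, e₂, h φ hφ hc hs, mul_neg]

theorem IsWeakDeriv.zero (U : Set ℝ) : IsWeakDeriv U 0 0 := by
  have h : ∀ ψ : ℝ → ℂ, ∫ x in U, (0 : L2 U) x * ψ x = 0 := by
    intro ψ
    refine integral_eq_zero_of_ae ?_
    filter_upwards [Lp.coeFn_zero ℂ 2 ((volume : Measure ℝ).restrict U)] with x hx
    rw [hx, Pi.zero_apply, zero_mul]
  intro φ _ _ _
  rw [h, h, neg_zero]

/-- The Sobolev space `W^{1,2}(U)` for open `U ⊆ ℝ`. A function `v` is represented by the pair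
`(v, v')` of `v` and its (unique) weak derivative in `L²(U)`, so that the inherited norm is
`(‖v‖²_{L²(U)} + ‖v'‖²_{L²(U)})^{1/2}`. -/
def W12 (U : Set ℝ) : Submodule ℂ (WithLp 2 (L2 U × L2 U)) where
  carrier := {p | IsWeakDeriv U p.fst p.snd}
  add_mem' h₁ h₂ := IsWeakDeriv.add h₁ h₂
  zero_mem' := IsWeakDeriv.zero U
  smul_mem' c _ h := IsWeakDeriv.smul c h

/-- The underlying function of an element of `W^{1,2}(U)`. -/
def valFn {U : Set ℝ} (v : W12 U) : L2 U := (v : WithLp 2 (L2 U × L2 U)).fst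

/-- The weak derivative `v'` of an element of `W^{1,2}(U)`. -/
def weakDeriv {U : Set ℝ} (v : W12 U) : L2 U := (v : WithLp 2 (L2 U × L2 U)).snd

/-- The truncated integral `(1/π) ∫_{|x-t| ≥ ε} f(t) / (x-t) dt`. -/
def truncatedHilbert (f : ℝ → ℂ) (x ε : ℝ) : ℂ :=
  (1 / (Real.pi : ℂ)) * ∫ t in {t : ℝ | ε ≤ |x - t|}, f t / ((x : ℂ) - (t : ℂ))

/-- The principal value defining the Hilbert transform of `f` at `x` exists. -/
def HilbertExistsAt (f : ℝ → ℂ) (x : ℝ) : Prop :=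
  ∃ y : ℂ, Tendsto (truncatedHilbert f x) (𝓝[>] 0) (𝓝 y)

/-- The Hilbert transform `(ℋ f)(x) = (1/π) P.V. ∫ f(t) / (x-t) dt`
(meaningful at the points where `HilbertExistsAt f x`). -/
def hilbertTransform (f : ℝ → ℂ) (x : ℝ) : ℂ :=
  limUnder (𝓝[>] 0) (truncatedHilbert f x)

/-- The Dirichlet-to-Neumann map of the upper half-plane: `Λ_ℍ u = - ℋ u'`, `u ∈ W^{1,2}(ℝ)`. -/
def lambdaH (u : W12 Set.univ) (x : ℝ) : ℂ := - hilbertTransform (weakDeriv u) x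

/-- The extension `η(v)` of `v : ℰ → ℂ` to `ℝ` by inversion: `v(x)` for `|x| > 1`, `v(1/x)` for
`0 < |x| < 1` and `0` at `0`. (The values at the two points `±1` play no role.) -/
def eta (v : ℝ → ℂ) (x : ℝ) : ℂ :=
  if 1 < |x| then v x else if x = 0 then 0 else v (1 / x)

/-- `v ∈ V₀(ℰ)`: the (essential) support of `v ∈ W^{1,2}(ℰ)` is a compact subset of `ℝ`; it may
contain the points `±1`. -/
def MemV0 (v : W12 freeSurface) : Prop :=
  ∃ K : Set ℝ, IsCompact K ∧ ∀ᵐ x ∂(volume.restrict freeSurface), x ∉ K → valFn v x = 0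

/-- `f` is `Λ_Ω v` for `v ∈ V₀(ℰ)`: the function `η(v)` belongs to `W^{1,2}(ℝ)` and `f` is the
restriction of `Λ_ℍ (η(v))` to `ℰ` (where the principal value exists almost everywhere). -/
def IsLambdaOmega (v : W12 freeSurface) (f : L2 freeSurface) : Prop :=
  ∃ u : W12 Set.univ, (∀ᵐ x : ℝ, valFn u x = eta (valFn v) x) ∧
    ∀ᵐ x ∂(volume.restrict freeSurface),
      HilbertExistsAt (weakDeriv u) x ∧ f x = lambdaH u x

/-- `g(v)`: the extension of `v'` by zero outside `ℰ`. -/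
def gExt (v : W12 freeSurface) : ℝ → ℂ := freeSurface.indicator (weakDeriv v)

end FloatingDisk

end

open FloatingDisk

/-!
On `L²(ℝ)` the Fourier multiplier `-i sgn ξ` turns the Poisson kernel into the conjugate Poisson
kernel, and the latter differs from the truncated kernel `1 / s` by a function of integral zero
dominated by the Poisson kernel. At a common Lebesgue point of `f` and of its multiplier transform
the truncated integrals therefore converge, so `ℋ` is a bounded operator on `L²(ℝ)` given almost
everywhere by principal values.

For `v ∈ V₀(ℰ)` the weak derivative of `η(v)` is `g(v) - t⁻² g(v)(1/t)`. In the principal value of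
its second summand the substitution `s = 1/t` and the identity
`-1 / (x - 1/s) = x⁻² / (1/x - s) - 1/x` produce `x⁻² ℋ(g(v))(1/x)` and a multiple of
`x⁻¹ ∫ g(v)`, where `∫ g(v) = v(-1) - v(1)`.

Each term of the resulting formula is bounded from `W^{1,2}(ℰ)` to `L²(ℰ)`: the trace `v(1) - v(-1)`
is continuous, and so is `f ↦ x⁻² f(1/x)`, because `f ↦ x⁻¹ f(1/x)` is an isometry of `L²(ℝ)` and
`|x⁻¹| ≤ 1` on `ℰ`. Uniqueness is the density of `V₀(ℰ)`, obtained by smooth cutoffs.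
-/

noncomputable section

namespace FloatingDisk

open Set Metric
open scoped ENNReal FourierTransform

section LebesguePoints

variable {E : Type*} [NormedAddCommGroup E] {f : ℝ → E} {p : ℝ≥0∞} {x ε : ℝ}

/-- `x` is a Lebesgue point of `f`. The averages are taken in `[0, ∞]`, so that no integrability
of `f` is presupposed. -/
def IsLebesguePoint (f : ℝ → E) (x : ℝ) : Prop :=
  Tendsto (fun r => ⨍⁻ y in closedBall x r, ‖f y - f x‖ₑ ∂volume) (𝓝[>] 0) (𝓝 0)

theorem ae_isLebesguePoint (hf : LocallyIntegrable f) : ∀ᵐ x, IsLebesguePoint f x := by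
  filter_upwards [(Besicovitch.vitaliFamily volume).ae_tendsto_lintegral_enorm_sub_div hf] with x hx
  simpa only [IsLebesguePoint, setLAverage_eq, Function.comp_def] using
    hx.comp (Besicovitch.tendsto_filterAt volume x)

theorem setLAverage_enorm_le_eLpNorm_div {α : Type*} [MeasurableSpace α] {μ : Measure α}
    {f : α → E} {s : Set α} (hf : AEStronglyMeasurable f μ) (hp : 1 ≤ p) (h0 : μ s ≠ 0)
    (h1 : μ s ≠ ⊤) :
    ⨍⁻ y in s, ‖f y‖ₑ ∂μ ≤ eLpNorm f p μ / μ s ^ (1 / p.toReal) := by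
  have holder : ∫⁻ y in s, ‖f y‖ₑ ∂μ ≤ eLpNorm f p μ * μ s ^ (1 - 1 / p.toReal) := by
    rw [← eLpNorm_one_eq_lintegral_enorm]
    refine (eLpNorm_le_eLpNorm_mul_rpow_measure_univ hp hf.restrict).trans ?_
    rw [Measure.restrict_apply_univ, ENNReal.toReal_one, div_one]
    gcongr
    exact Measure.restrict_le_self
  calc ⨍⁻ y in s, ‖f y‖ₑ ∂μ
      ≤ eLpNorm f p μ * μ s ^ (1 - 1 / p.toReal) / μ s := by
        rw [setLAverage_eq]; gcongr
    _ = eLpNorm f p μ / μ s ^ (1 / p.toReal) := by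
        rw [mul_div_assoc, sub_eq_neg_add, ENNReal.rpow_add _ _ h0 h1, ENNReal.rpow_one,
          ENNReal.mul_div_cancel_right h0 h1, ENNReal.rpow_neg, div_eq_mul_inv (eLpNorm f p μ)]

theorem setLAverage_enorm_sub_le {α : Type*} [MeasurableSpace α] {μ : Measure α} {f : α → E}
    {s : Set α} (c : E) (h0 : μ s ≠ 0) (h1 : μ s ≠ ⊤) :
    ⨍⁻ y in s, ‖f y - c‖ₑ ∂μ ≤ ⨍⁻ y in s, ‖f y‖ₑ ∂μ + ‖c‖ₑ :=
  calc ⨍⁻ y in s, ‖f y - c‖ₑ ∂μ ≤ (∫⁻ y in s, (‖f y‖ₑ + ‖c‖ₑ) ∂μ) / μ s := by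
        rw [setLAverage_eq]
        gcongr
        exact enorm_sub_le
    _ = ⨍⁻ y in s, ‖f y‖ₑ ∂μ + ‖c‖ₑ := by
        rw [lintegral_add_right _ measurable_const, setLIntegral_const, ENNReal.add_div,
          setLAverage_eq, mul_div_assoc, ENNReal.div_self h0 h1, mul_one]

theorem IsLebesguePoint.exists_setLAverage_le (hx : IsLebesguePoint f x) (hf : MemLp f p)
    (hp : 1 ≤ p) :
    ∃ C : ℝ≥0∞, C ≠ ⊤ ∧ ∀ r > 0, ⨍⁻ y in closedBall x r, ‖f y - f x‖ₑ ∂volume ≤ C := by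
  obtain ⟨δ, hδ, hsmall⟩ := mem_nhdsGT_iff_exists_Ioc_subset.1
    (hx.eventually (gt_mem_nhds one_pos))
  have hδ : 0 < δ := hδ
  set L : ℝ≥0∞ := eLpNorm f p volume / ENNReal.ofReal (2 * δ) ^ (1 / p.toReal) + ‖f x‖ₑ
  have hL : L ≠ ⊤ := by
    have : ENNReal.ofReal (2 * δ) ^ (1 / p.toReal) ≠ 0 :=
      (ENNReal.rpow_pos (by simpa using hδ) ENNReal.ofReal_ne_top).ne'
    exact ENNReal.add_ne_top.2 ⟨ENNReal.div_ne_top hf.eLpNorm_ne_top this, enorm_ne_top⟩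
  refine ⟨1 + L, ENNReal.add_ne_top.2 ⟨ENNReal.one_ne_top, hL⟩, fun r hr => ?_⟩
  rcases le_or_gt r δ with h | h
  · exact (le_of_lt (hsmall ⟨hr, h⟩)).trans le_self_add
  · have hball : volume (closedBall x r) = ENNReal.ofReal (2 * r) := Real.volume_closedBall x r
    have h0 : volume (closedBall x r) ≠ 0 := by rw [hball]; simpa using hr
    have h1 : volume (closedBall x r) ≠ ⊤ := by rw [hball]; exact ENNReal.ofReal_ne_top
    calc ⨍⁻ y in closedBall x r, ‖f y - f x‖ₑ ∂volume
        ≤ ⨍⁻ y in closedBall x r, ‖f y‖ₑ ∂volume + ‖f x‖ₑ := setLAverage_enorm_sub_le _ h0 h1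
      _ ≤ L := by
          refine add_le_add_left ((setLAverage_enorm_le_eLpNorm_div hf.1 hp h0 h1).trans ?_) _
          rw [hball]
          gcongr
      _ ≤ 1 + L := le_add_self

/-- The Poisson kernel of the upper half-plane, up to the factor `1 / π`. -/
def poissonKernel (ε s : ℝ) : ℝ := ε / (s ^ 2 + ε ^ 2)

theorem poissonKernel_nonneg (hε : 0 ≤ ε) (s : ℝ) : 0 ≤ poissonKernel ε s :=
  div_nonneg hε (by positivity)

theorem exists_poissonKernel_le (hε : 0 < ε) (s : ℝ) :
    ∃ k : ℕ, |s| ≤ 2 ^ k * ε ∧ poissonKernel ε s ≤ 4 * (1 / 4) ^ k / ε := by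
  rw [poissonKernel]
  rcases le_or_gt |s| ε with h | h
  · refine ⟨0, by simpa using h, ?_⟩
    rw [div_le_div_iff₀ (by positivity) hε]
    nlinarith [sq_nonneg s, sq_nonneg ε]
  · obtain ⟨n, hlow, hupp⟩ := exists_nat_pow_near (x := |s| / ε) (y := 2)
      ((one_le_div hε).2 h.le) one_lt_two
    rw [le_div_iff₀ hε] at hlow
    rw [div_lt_iff₀ hε] at hupp
    refine ⟨n + 1, hupp.le, ?_⟩
    have hsq : (2 ^ n * ε) ^ 2 ≤ s ^ 2 := by
      rw [← sq_abs s]; gcongr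
    have hpow : (4 : ℝ) ^ n = (2 ^ n) ^ 2 := by rw [← pow_mul, mul_comm, pow_mul]; norm_num
    calc ε / (s ^ 2 + ε ^ 2) ≤ ε / (2 ^ n * ε) ^ 2 := by
          gcongr
          nlinarith [sq_nonneg ε]
      _ = 4 * (1 / 4) ^ (n + 1) / ε := by
          rw [mul_pow, ← hpow, pow_succ, div_pow, one_pow, pow_succ]; field_simp; ring

theorem lintegral_poissonKernel_mul_le (hε : 0 < ε) {u : ℝ → ℝ≥0∞} (hu : AEMeasurable u) (x : ℝ) :
    ∫⁻ t, ENNReal.ofReal (poissonKernel ε (x - t)) * u t ≤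
      ∑' k : ℕ,
        ENNReal.ofReal (8 * (1 / 2) ^ k) * ⨍⁻ t in closedBall x (2 ^ k * ε), u t ∂volume := by
  set c : ℕ → ℝ≥0∞ := fun k => ENNReal.ofReal (4 * (1 / 4) ^ k / ε)
  set B : ℕ → Set ℝ := fun k => closedBall x (2 ^ k * ε)
  have hB : ∀ k, MeasurableSet (B k) := fun k => isClosed_closedBall.measurableSet
  calc ∫⁻ t, ENNReal.ofReal (poissonKernel ε (x - t)) * u t
      ≤ ∫⁻ t, ∑' k, (B k).indicator (fun t => c k * u t) t := by
        refine lintegral_mono fun t => ?_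
        obtain ⟨k, hk, hle⟩ := exists_poissonKernel_le hε (x - t)
        refine le_trans ?_ (ENNReal.le_tsum k)
        rw [indicator_of_mem (by rwa [mem_closedBall, Real.dist_eq, abs_sub_comm])]
        exact mul_le_mul_left (ENNReal.ofReal_le_ofReal hle) _
    _ = ∑' k, c k * ∫⁻ t in B k, u t := by
        rw [lintegral_tsum fun k => (hu.const_mul _).indicator (hB k)]
        exact tsum_congr fun k => by
          rw [lintegral_indicator (hB k), lintegral_const_mul' _ _ ENNReal.ofReal_ne_top]
    _ = ∑' k, ENNReal.ofReal (8 * (1 / 2) ^ k) * ⨍⁻ t in B k, u t ∂volume := by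
        refine tsum_congr fun k => ?_
        have hpow : (1 / 4 : ℝ) ^ k * 2 ^ k = (1 / 2) ^ k := by rw [← mul_pow]; norm_num
        have hweight : 8 * (1 / 2 : ℝ) ^ k = 4 * (1 / 4) ^ k / ε * (2 * (2 ^ k * ε)) := by
          rw [← hpow]; field_simp; norm_num
        have hvol : volume (B k) = ENNReal.ofReal (2 * (2 ^ k * ε)) := Real.volume_closedBall ..
        rw [setLAverage_eq, hweight, ENNReal.ofReal_mul (by positivity), hvol, mul_assoc,
          ENNReal.mul_div_cancel (by simpa using hε) ENNReal.ofReal_ne_top]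

theorem IsLebesguePoint.tendsto_lintegral_poissonKernel_mul (hx : IsLebesguePoint f x)
    (hf : MemLp f p) (hp : 1 ≤ p) :
    Tendsto (fun ε => ∫⁻ t, ENNReal.ofReal (poissonKernel ε (x - t)) * ‖f t - f x‖ₑ)
      (𝓝[>] 0) (𝓝 0) := by
  set A : ℝ → ℝ≥0∞ := fun r => ⨍⁻ y in closedBall x r, ‖f y - f x‖ₑ ∂volume
  obtain ⟨C, hC, hAC⟩ := hx.exists_setLAverage_le hf hp
  have hscale (k : ℕ) : Tendsto (fun ε : ℝ => 2 ^ k * ε) (𝓝[>] 0) (𝓝[>] 0) := by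
    refine tendsto_nhdsWithin_iff.2 ⟨?_, ?_⟩
    · refine tendsto_nhdsWithin_of_tendsto_nhds ?_
      simpa using (tendsto_id (α := ℝ) (x := 𝓝 0)).const_mul (2 ^ k)
    · filter_upwards [self_mem_nhdsWithin] with ε hε
      exact mem_Ioi.2 (mul_pos (pow_pos two_pos k) hε)
  have hgeom : ∑' k : ℕ, ENNReal.ofReal (8 * (1 / 2 : ℝ) ^ k) * C ≠ ⊤ := by
    rw [ENNReal.tsum_mul_right]
    exact ENNReal.mul_ne_top (summable_geometric_two.mul_left 8).tsum_ofReal_ne_top hC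
  have hsum : Tendsto (fun ε => ∑' k : ℕ, ENNReal.ofReal (8 * (1 / 2) ^ k) * A (2 ^ k * ε))
      (𝓝[>] 0) (𝓝 (∑' _ : ℕ, 0)) := by
    simp_rw [← lintegral_count] at hgeom ⊢
    refine tendsto_lintegral_filter_of_dominated_convergence _
      (Eventually.of_forall fun ε => measurable_from_top) ?_ hgeom
      (Eventually.of_forall fun k => ?_)
    · filter_upwards [self_mem_nhdsWithin] with ε hε
      refine Eventually.of_forall fun k => ?_
      gcongr
      exact hAC _ (mul_pos (by positivity) hε)
    · simpa only [mul_zero, Function.comp_def] using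
        ENNReal.Tendsto.const_mul (hx.comp (hscale k)) (Or.inr ENNReal.ofReal_ne_top)
  rw [tsum_zero] at hsum
  refine tendsto_of_tendsto_of_tendsto_of_le_of_le' tendsto_const_nhds hsum
    (Eventually.of_forall fun ε => zero_le) ?_
  filter_upwards [self_mem_nhdsWithin] with ε hε
  exact lintegral_poissonKernel_mul_le hε (hf.1.sub aestronglyMeasurable_const).enorm x

end LebesguePoints

section Kernels

variable {f : ℝ → ℂ} {k : ℝ → ℝ} {ε x c C : ℝ}

theorem integrable_poissonKernel (hε : 0 < ε) : Integrable (poissonKernel ε) := by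
  refine ((integrable_inv_one_add_sq.comp_mul_left' (inv_ne_zero hε.ne')).const_mul ε⁻¹).congr
    (Eventually.of_forall fun s => ?_)
  simp only [poissonKernel]
  field_simp
  ring

theorem integral_poissonKernel (hε : 0 < ε) : ∫ s, poissonKernel ε s = Real.pi := by
  have hscale : ∀ s, poissonKernel ε s = ε⁻¹ * (1 + (ε⁻¹ * s) ^ 2)⁻¹ := fun s => by
    rw [poissonKernel]; field_simp; ring
  simp_rw [hscale]
  rw [integral_const_mul, Measure.integral_comp_mul_left (fun s => (1 + s ^ 2)⁻¹),
    integral_univ_inv_one_add_sq, inv_inv, abs_of_pos hε, smul_eq_mul, inv_mul_cancel_left₀ hε.ne']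

theorem memLp_two_of_sq_le_poissonKernel (hε : 0 < ε) (hk : AEStronglyMeasurable k)
    (hle : ∀ s, k s ^ 2 ≤ C * poissonKernel ε s) : MemLp k 2 := by
  refine (memLp_two_iff_integrable_sq hk).2 (((integrable_poissonKernel hε).const_mul C).mono'
    (hk.pow 2) (Eventually.of_forall fun s => ?_))
  rw [Real.norm_of_nonneg (sq_nonneg _)]
  exact hle s

theorem memLp_two_of_abs_le_poissonKernel (hε : 0 < ε) (hk : AEStronglyMeasurable k)
    (hle : ∀ s, |k s| ≤ poissonKernel ε s) : MemLp k 2 := by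
  refine memLp_two_of_sq_le_poissonKernel (C := ε⁻¹) hε hk fun s => ?_
  have hsup : poissonKernel ε s ≤ ε⁻¹ := by
    rw [poissonKernel, inv_eq_one_div, div_le_div_iff₀ (by positivity) hε]
    nlinarith [sq_nonneg s]
  calc k s ^ 2 ≤ poissonKernel ε s ^ 2 := by rw [← sq_abs]; gcongr; exact hle s
    _ ≤ ε⁻¹ * poissonKernel ε s := by
        rw [sq]; exact mul_le_mul_of_nonneg_right hsup (poissonKernel_nonneg hε.le s)

theorem memLp_comp_sub_left (hk : MemLp k 2) (x : ℝ) : MemLp (fun t => (k (x - t) : ℂ)) 2 :=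
  (hk.comp_measurePreserving (volume.measurePreserving_sub_left x)).ofReal

theorem integrable_mul_comp_sub_left (hf : MemLp f 2) (hk : MemLp k 2) (x : ℝ) :
    Integrable fun t => f t * (k (x - t) : ℂ) :=
  hf.integrable_mul (q := 2) (memLp_comp_sub_left hk x)

/-- Kernels dominated by the Poisson kernel do not see the oscillation of `f` at a Lebesgue
point. -/
theorem IsLebesguePoint.tendsto_integral_mul {k : ℝ → ℝ → ℝ} (hx : IsLebesguePoint f x)
    (hf : MemLp f 2) (hkm : ∀ ε, Measurable (k ε))
    (hk : ∀ ε > 0, ∀ s, |k ε s| ≤ poissonKernel ε s) (hc : ∀ ε > 0, ∫ s, k ε s = c) :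
    Tendsto (fun ε => ∫ t, f t * (k ε (x - t) : ℂ)) (𝓝[>] 0) (𝓝 (f x * c)) := by
  rw [tendsto_iff_edist_tendsto_0]
  refine tendsto_of_tendsto_of_tendsto_of_le_of_le' tendsto_const_nhds
    (hx.tendsto_lintegral_poissonKernel_mul hf one_le_two)
    (Eventually.of_forall fun _ => zero_le) ?_
  filter_upwards [self_mem_nhdsWithin] with ε hε
  have hki : Integrable fun t => (k ε (x - t) : ℂ) :=
    (((integrable_poissonKernel hε).mono' (hkm ε).aestronglyMeasurable
      (Eventually.of_forall (hk ε hε))).comp_sub_left x).ofReal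
  have hfk : Integrable fun t => f t * (k ε (x - t) : ℂ) := integrable_mul_comp_sub_left hf
    (memLp_two_of_abs_le_poissonKernel hε (hkm ε).aestronglyMeasurable (hk ε hε)) x
  have hosc : (∫ t, f t * (k ε (x - t) : ℂ)) - f x * c = ∫ t, (k ε (x - t) : ℂ) * (f t - f x) := by
    have hmass : ∫ t, (k ε (x - t) : ℂ) = c := by
      rw [integral_complex_ofReal, integral_sub_left_eq_self (k ε) volume x, hc ε hε]
    rw [← hmass, ← integral_const_mul, ← integral_sub hfk (hki.const_mul _)]
    exact integral_congr_ae (Eventually.of_forall fun t => by ring)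
  rw [edist_eq_enorm_sub, hosc]
  refine (enorm_integral_le_lintegral_enorm _).trans (lintegral_mono fun t => ?_)
  rw [enorm_mul, ← ofReal_norm, Complex.norm_real]
  gcongr
  exact hk ε hε _

/-- The conjugate Poisson kernel of the upper half-plane, up to the factor `1 / π`. -/
def conjPoissonKernel (ε s : ℝ) : ℝ := s / (s ^ 2 + ε ^ 2)

theorem memLp_conjPoissonKernel (hε : 0 < ε) : MemLp (conjPoissonKernel ε) 2 := by
  have hm : Measurable (conjPoissonKernel ε) := by unfold conjPoissonKernel; fun_prop
  refine memLp_two_of_sq_le_poissonKernel (C := ε⁻¹) hε hm.aestronglyMeasurable fun s => ?_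
  calc conjPoissonKernel ε s ^ 2 = s ^ 2 / (s ^ 2 + ε ^ 2) ^ 2 := div_pow ..
    _ ≤ (s ^ 2 + ε ^ 2) / (s ^ 2 + ε ^ 2) ^ 2 := by
        gcongr
        exact le_add_of_nonneg_right (sq_nonneg ε)
    _ = ε⁻¹ * poissonKernel ε s := by rw [poissonKernel]; field_simp

theorem memLp_poissonKernel (hε : 0 < ε) : MemLp (poissonKernel ε) 2 :=
  memLp_two_of_abs_le_poissonKernel hε (integrable_poissonKernel hε).1 fun s =>
    (abs_of_nonneg (poissonKernel_nonneg hε.le s)).le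

/-- The kernel `1 / s`, cut off at distance `ε` from its singularity. -/
def truncatedKernel (ε s : ℝ) : ℝ := if ε ≤ |s| then 1 / s else 0

theorem measurable_truncatedKernel (ε : ℝ) : Measurable (truncatedKernel ε) :=
  Measurable.ite (measurableSet_le measurable_const (by fun_prop)) (by fun_prop) measurable_const

theorem memLp_truncatedKernel (hε : 0 < ε) : MemLp (truncatedKernel ε) 2 := by
  refine memLp_two_of_sq_le_poissonKernel (C := 2 / ε) hε
    (measurable_truncatedKernel ε).aestronglyMeasurable fun s => ?_
  rw [truncatedKernel, poissonKernel]
  split_ifs with h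
  · have hsq : ε ^ 2 ≤ s ^ 2 := by rw [← sq_abs s]; gcongr
    have hs : 0 < s ^ 2 := lt_of_lt_of_le (by positivity) hsq
    calc (1 / s) ^ 2 = 2 / (s ^ 2 + s ^ 2) := by rw [← two_mul, div_pow, one_pow]; field_simp
      _ ≤ 2 / (s ^ 2 + ε ^ 2) := by gcongr
      _ = 2 / ε * (ε / (s ^ 2 + ε ^ 2)) := by field_simp
  · have : 0 ≤ ε / (s ^ 2 + ε ^ 2) := by positivity
    rw [zero_pow two_ne_zero]
    positivity

theorem truncatedHilbert_eq_integral (f : ℝ → ℂ) (x ε : ℝ) :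
    truncatedHilbert f x ε = 1 / (Real.pi : ℂ) * ∫ t, f t * (truncatedKernel ε (x - t) : ℂ) := by
  rw [truncatedHilbert, ← integral_indicator (measurableSet_le measurable_const (by fun_prop))]
  congr 1
  refine integral_congr_ae (Eventually.of_forall fun t => ?_)
  by_cases h : ε ≤ |x - t| <;> simp [truncatedKernel, h, div_eq_mul_inv]

theorem abs_conjPoissonKernel_sub_truncatedKernel_le (hε : 0 < ε) (s : ℝ) :
    |conjPoissonKernel ε s - truncatedKernel ε s| ≤ poissonKernel ε s := by
  have hpos : 0 < s ^ 2 + ε ^ 2 := by positivity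
  rw [conjPoissonKernel, truncatedKernel, poissonKernel]
  split_ifs with h
  · have hs : 0 < |s| := hε.trans_le h
    have hs0 : s ≠ 0 := abs_pos.1 hs
    have hdiff : s / (s ^ 2 + ε ^ 2) - 1 / s = -(ε ^ 2 / (s * (s ^ 2 + ε ^ 2))) := by
      field_simp; ring
    rw [hdiff, abs_neg, abs_div, abs_mul, abs_of_pos hpos, abs_of_pos (pow_pos hε 2),
      div_le_div_iff₀ (by positivity) hpos]
    nlinarith [mul_le_mul_of_nonneg_right h (mul_pos hε hpos).le]
  · rw [sub_zero, abs_div, abs_of_pos hpos]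
    gcongr
    exact (not_le.1 h).le

theorem integral_conjPoissonKernel_sub_truncatedKernel (ε : ℝ) :
    ∫ s, (conjPoissonKernel ε s - truncatedKernel ε s) = 0 := by
  have hodd : ∀ s, conjPoissonKernel ε (-s) - truncatedKernel ε (-s) =
      -(conjPoissonKernel ε s - truncatedKernel ε s) := fun s => by
    simp only [conjPoissonKernel, truncatedKernel, abs_neg]
    split_ifs <;> ring
  have hreflect := integral_neg_eq_self
    (fun s => conjPoissonKernel ε s - truncatedKernel ε s) volume
  simp_rw [hodd] at hreflect
  rw [integral_neg] at hreflect
  exact self_eq_neg.1 hreflect.symm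

end Kernels

section HilbertTransform

variable {a b : ℂ} {ε x : ℝ}

/-- The exponential `ξ ↦ e ^ (2π (i x ξ - ε |ξ|))`, weighted by `a` on `(0, ∞)` and by `b` on
`(-∞, 0]`. Its Fourier transform is a combination of the Poisson kernel and its conjugate. -/
def twoSidedExp (a b : ℂ) (ε x : ℝ) : ℝ → ℂ :=
  (Ioi 0).piecewise (fun ξ => a * Complex.exp (2 * Real.pi * (-ε + x * Complex.I) * ξ))
    (fun ξ => b * Complex.exp (2 * Real.pi * (ε + x * Complex.I) * ξ))

theorem integrableOn_exp_Ioi (hε : 0 < ε) (x : ℝ) :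
    IntegrableOn (fun ξ : ℝ => Complex.exp (2 * Real.pi * (-ε + x * Complex.I) * ξ)) (Ioi 0) :=
  integrableOn_exp_mul_complex_Ioi (by simpa using by positivity) 0

theorem integrableOn_exp_Iic (hε : 0 < ε) (x : ℝ) :
    IntegrableOn (fun ξ : ℝ => Complex.exp (2 * Real.pi * (ε + x * Complex.I) * ξ)) (Iic 0) :=
  integrableOn_exp_mul_complex_Iic (by simpa using by positivity) 0

theorem integrable_twoSidedExp (hε : 0 < ε) : Integrable (twoSidedExp a b ε x) :=
  Integrable.piecewise measurableSet_Ioi ((integrableOn_exp_Ioi hε x).const_mul a)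
    (by rw [compl_Ioi]; exact (integrableOn_exp_Iic hε x).const_mul b)

theorem norm_twoSidedExp_le (hε : 0 < ε) (ξ : ℝ) : ‖twoSidedExp a b ε x ξ‖ ≤ max ‖a‖ ‖b‖ := by
  have hexp {z : ℂ} (h : z.re ≤ 0) (c : ℂ) : ‖c * Complex.exp z‖ ≤ ‖c‖ := by
    rw [norm_mul, Complex.norm_exp]
    exact mul_le_of_le_one_right (norm_nonneg c) (Real.exp_le_one_iff.2 h)
  by_cases h : ξ ∈ Ioi 0
  · rw [twoSidedExp, piecewise_eq_of_mem _ _ _ h]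
    refine (hexp ?_ a).trans (le_max_left _ _)
    have : 0 ≤ 2 * Real.pi * ε * ξ := mul_nonneg (by positivity) (le_of_lt h)
    simpa using this
  · rw [twoSidedExp, piecewise_eq_of_notMem _ _ _ h]
    refine (hexp ?_ b).trans (le_max_right _ _)
    simpa using mul_nonpos_of_nonneg_of_nonpos (by positivity : 0 ≤ 2 * Real.pi * ε)
      (not_lt.1 h)

theorem memLp_twoSidedExp (hε : 0 < ε) : MemLp (twoSidedExp a b ε x) 2 := by
  have hint : Integrable (twoSidedExp a b ε x) := integrable_twoSidedExp hε
  refine (memLp_two_iff_integrable_sq_norm hint.1).2 ((hint.norm.const_mul (max ‖a‖ ‖b‖)).mono'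
    (hint.1.norm.pow 2) (Eventually.of_forall fun ξ => ?_))
  rw [Real.norm_of_nonneg (sq_nonneg _), sq]
  exact mul_le_mul_of_nonneg_right (norm_twoSidedExp_le hε ξ) (norm_nonneg _)

theorem ofReal_add_mul_I_ne_zero (hε : ε ≠ 0) (x : ℝ) : (ε : ℂ) + x * Complex.I ≠ 0 :=
  fun h => hε (by simpa using congrArg Complex.re h)

theorem ofReal_sub_mul_I_ne_zero (hε : ε ≠ 0) (x : ℝ) : (ε : ℂ) - x * Complex.I ≠ 0 :=
  fun h => hε (by simpa using congrArg Complex.re h)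

theorem ofReal_sq_add_sq (ε x : ℝ) :
    (x : ℂ) ^ 2 + (ε : ℂ) ^ 2 = (ε - x * Complex.I) * (ε + x * Complex.I) := by
  linear_combination (x : ℂ) ^ 2 * Complex.I_sq

theorem integral_twoSidedExp (hε : 0 < ε) :
    ∫ ξ, twoSidedExp a b ε x ξ =
      (a / (ε - x * Complex.I) + b / (ε + x * Complex.I)) / (2 * Real.pi) := by
  have hminus := ofReal_sub_mul_I_ne_zero hε.ne' x
  have hplus := ofReal_add_mul_I_ne_zero hε.ne' x
  rw [twoSidedExp, integral_piecewise measurableSet_Ioi ((integrableOn_exp_Ioi hε x).const_mul a)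
    (by rw [compl_Ioi]; exact (integrableOn_exp_Iic hε x).const_mul b), compl_Ioi,
    integral_const_mul, integral_const_mul,
    integral_exp_mul_complex_Ioi (by simpa using by positivity),
    integral_exp_mul_complex_Iic (by simpa using by positivity),
    show (-ε + x * Complex.I : ℂ) = -(ε - x * Complex.I) by ring]
  simp only [Complex.ofReal_zero, mul_zero, Complex.exp_zero, mul_neg, neg_div_neg_eq]
  field_simp

theorem fourier_twoSidedExp (hε : 0 < ε) (t : ℝ) :
    𝓕 (twoSidedExp a b ε x) t =
      (a / (ε - (x - t : ℝ) * Complex.I) + b / (ε + (x - t : ℝ) * Complex.I)) /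
        (2 * Real.pi) := by
  have hmod (ξ : ℝ) : Complex.exp (↑(-2 * Real.pi * ξ * t) * Complex.I) •
      twoSidedExp a b ε x ξ = twoSidedExp a b ε (x - t) ξ := by
    by_cases h : ξ ∈ Ioi 0
    · simp only [twoSidedExp, piecewise_eq_of_mem _ _ _ h, smul_eq_mul]
      rw [mul_left_comm, ← Complex.exp_add]
      push_cast; ring_nf
    · simp only [twoSidedExp, piecewise_eq_of_notMem _ _ _ h, smul_eq_mul]
      rw [mul_left_comm, ← Complex.exp_add]
      push_cast; ring_nf
  simp_rw [Real.fourier_real_eq_integral_exp_smul, hmod]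
  exact integral_twoSidedExp hε

theorem fourier_twoSidedExp_one_one (hε : 0 < ε) :
    𝓕 (twoSidedExp 1 1 ε x) = fun t => (1 / Real.pi : ℂ) * (poissonKernel ε (x - t) : ℂ) := by
  funext t
  have hminus := ofReal_sub_mul_I_ne_zero hε.ne' (x - t)
  have hplus := ofReal_add_mul_I_ne_zero hε.ne' (x - t)
  rw [fourier_twoSidedExp hε, poissonKernel, Complex.ofReal_div, Complex.ofReal_add,
    Complex.ofReal_pow, Complex.ofReal_pow, ofReal_sq_add_sq]
  field_simp
  ring

theorem fourier_twoSidedExp_neg_I_I (hε : 0 < ε) :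
    𝓕 (twoSidedExp (-Complex.I) Complex.I ε x) =
      fun t => (1 / Real.pi : ℂ) * (conjPoissonKernel ε (x - t) : ℂ) := by
  funext t
  have hminus := ofReal_sub_mul_I_ne_zero hε.ne' (x - t)
  have hplus := ofReal_add_mul_I_ne_zero hε.ne' (x - t)
  rw [fourier_twoSidedExp hε, conjPoissonKernel, Complex.ofReal_div, Complex.ofReal_add,
    Complex.ofReal_pow, Complex.ofReal_pow, ofReal_sq_add_sq]
  have hnum : -Complex.I * (ε + (x - t : ℝ) * Complex.I) +
      (ε - (x - t : ℝ) * Complex.I) * Complex.I = 2 * (x - t : ℝ) := by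
    linear_combination (-2 * (x - t : ℝ) : ℂ) * Complex.I_sq
  rw [div_add_div _ _ hminus hplus, hnum]
  field_simp

/-- The bounded functional `h ↦ ∫ h k` on `L^p`, for `k` in the dual space `L^q`. -/
def integralMulCLM {α : Type*} [MeasurableSpace α] {μ : Measure α} {p q : ℝ≥0∞}
    [Fact (1 ≤ p)] [Fact (1 ≤ q)] [p.HolderConjugate q] {k : α → ℂ} (hk : MemLp k q μ) :
    Lp ℂ p μ →L[ℂ] ℂ :=
  ((ContinuousLinearMap.mul ℂ ℂ).lpPairing μ p q).flip (hk.toLp k)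

theorem integralMulCLM_apply {α : Type*} [MeasurableSpace α] {μ : Measure α} {p q : ℝ≥0∞}
    [Fact (1 ≤ p)] [Fact (1 ≤ q)] [p.HolderConjugate q] {k : α → ℂ} (hk : MemLp k q μ)
    (h : Lp ℂ p μ) : integralMulCLM hk h = ∫ t, h t * k t ∂μ := by
  rw [integralMulCLM, ContinuousLinearMap.flip_apply, ContinuousLinearMap.lpPairing_eq_integral]
  refine integral_congr_ae ?_
  filter_upwards [hk.coeFn_toLp] with t ht
  rw [ht, ContinuousLinearMap.mul_apply']

theorem integral_fourier_mul {m : ℝ → ℂ} (h : Lp ℂ 2 (volume : Measure ℝ)) (hm : Integrable m)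
    (hm2 : MemLp m 2) (hFm : MemLp (𝓕 m) 2) :
    ∫ ξ, (𝓕 h : Lp ℂ 2 volume) ξ * m ξ = ∫ t, h t * 𝓕 m t := by
  have hleft : Continuous fun h : Lp ℂ 2 (volume : Measure ℝ) => integralMulCLM hm2 (𝓕 h) :=
    (integralMulCLM hm2).continuous.comp (Lp.fourierTransformₗᵢ ℝ ℂ).continuous
  have hright : Continuous fun h : Lp ℂ 2 (volume : Measure ℝ) => integralMulCLM hFm h :=
    (integralMulCLM hFm).continuous
  simp only [integralMulCLM_apply] at hleft hright
  refine congrFun (DenseRange.equalizer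
    (SchwartzMap.denseRange_toLpCLM (E := ℝ) (F := ℂ) (p := 2) (μ := volume) (by simp))
    hleft hright (funext fun φ => ?_)) h
  simp only [Function.comp_apply, SchwartzMap.toLpCLM_apply, SchwartzMap.toLp_fourier_eq]
  calc ∫ ξ, (𝓕 φ).toLp 2 volume ξ * m ξ = ∫ ξ, 𝓕 (φ : ℝ → ℂ) ξ * m ξ := by
        refine integral_congr_ae ?_
        filter_upwards [(𝓕 φ).coeFn_toLp 2 volume] with ξ hξ
        rw [hξ, SchwartzMap.fourier_coe]
    _ = ∫ t, φ t * 𝓕 m t := by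
        simpa using! (VectorFourier.integral_fourierIntegral_smul_eq_flip (L := innerₗ ℝ)
          Real.continuous_fourierChar continuous_inner φ.integrable hm)
    _ = ∫ t, φ.toLp 2 volume t * 𝓕 m t := by
        refine integral_congr_ae ?_
        filter_upwards [φ.coeFn_toLp 2 volume] with t ht
        rw [ht]

/-- The symbol `-i sgn ξ` of the Hilbert transform (with an irrelevant value at `0`). -/
def hilbertMultiplier (ξ : ℝ) : ℂ := if 0 < ξ then -Complex.I else Complex.I

theorem memLp_hilbertMultiplier : MemLp hilbertMultiplier ⊤ (volume : Measure ℝ) := by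
  have hm : Measurable hilbertMultiplier :=
    Measurable.ite measurableSet_Ioi measurable_const measurable_const
  refine memLp_top_of_bound hm.aestronglyMeasurable 1 (Eventually.of_forall fun ξ => ?_)
  unfold hilbertMultiplier; split_ifs <;> simp

theorem hilbertMultiplier_mul_twoSidedExp (ξ : ℝ) :
    hilbertMultiplier ξ * twoSidedExp a b ε x ξ =
      twoSidedExp (-Complex.I * a) (Complex.I * b) ε x ξ := by
  by_cases h : 0 < ξ <;> simp [hilbertMultiplier, twoSidedExp, piecewise, h, mul_assoc]

/-- The Hilbert transform on `L²(ℝ)`, defined as a Fourier multiplier; by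
`ae_tendsto_truncatedHilbert` it is given by the principal values. -/
def hilbertCLM : Lp ℂ 2 (volume : Measure ℝ) →L[ℂ] Lp ℂ 2 (volume : Measure ℝ) :=
  ((Lp.fourierTransformₗᵢ ℝ ℂ).symm : Lp ℂ 2 (volume : Measure ℝ) →L[ℂ] Lp ℂ 2 volume) ∘L
    (ContinuousLinearMap.mul ℂ ℂ).holderL volume ⊤ 2 2 (memLp_hilbertMultiplier.toLp _) ∘L
    ((Lp.fourierTransformₗᵢ ℝ ℂ) : Lp ℂ 2 (volume : Measure ℝ) →L[ℂ] Lp ℂ 2 volume)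

theorem fourier_hilbertCLM (f : Lp ℂ 2 (volume : Measure ℝ)) :
    ∀ᵐ ξ, (𝓕 (hilbertCLM f) : Lp ℂ 2 volume) ξ =
      hilbertMultiplier ξ * (𝓕 f : Lp ℂ 2 volume) ξ := by
  have hmul : (𝓕 (hilbertCLM f) : Lp ℂ 2 (volume : Measure ℝ)) =
      (ContinuousLinearMap.mul ℂ ℂ).holder 2 (memLp_hilbertMultiplier.toLp _) (𝓕 f) :=
    (Lp.fourierTransformₗᵢ ℝ ℂ).apply_symm_apply _
  rw [hmul]
  filter_upwards [(ContinuousLinearMap.mul ℂ ℂ).coeFn_holder (r := 2)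
    (memLp_hilbertMultiplier.toLp _) (𝓕 f : Lp ℂ 2 (volume : Measure ℝ)),
    memLp_hilbertMultiplier.coeFn_toLp] with ξ hholder hσ
  rw [hholder, hσ, ContinuousLinearMap.mul_apply']

theorem integral_hilbertCLM_mul_poissonKernel (f : Lp ℂ 2 (volume : Measure ℝ)) (hε : 0 < ε)
    (x : ℝ) :
    ∫ t, hilbertCLM f t * (poissonKernel ε (x - t) : ℂ) =
      ∫ t, f t * (conjPoissonKernel ε (x - t) : ℂ) := by
  have hpi : (1 / Real.pi : ℂ) ≠ 0 := by simp [Real.pi_ne_zero]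
  have hP : MemLp (𝓕 (twoSidedExp 1 1 ε x)) 2 := by
    rw [fourier_twoSidedExp_one_one hε]
    exact (memLp_comp_sub_left (memLp_poissonKernel hε) x).const_mul _
  have hQ : MemLp (𝓕 (twoSidedExp (-Complex.I) Complex.I ε x)) 2 := by
    rw [fourier_twoSidedExp_neg_I_I hε]
    exact (memLp_comp_sub_left (memLp_conjPoissonKernel hε) x).const_mul _
  refine mul_left_cancel₀ hpi ?_
  simp_rw [← integral_const_mul, mul_left_comm (1 / Real.pi : ℂ)]
  calc ∫ t, hilbertCLM f t * ((1 / Real.pi : ℂ) * (poissonKernel ε (x - t) : ℂ))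
      = ∫ ξ, (𝓕 (hilbertCLM f) : Lp ℂ 2 volume) ξ * twoSidedExp 1 1 ε x ξ := by
        rw [integral_fourier_mul _ (integrable_twoSidedExp hε) (memLp_twoSidedExp hε) hP,
          fourier_twoSidedExp_one_one hε]
    _ = ∫ ξ, (𝓕 f : Lp ℂ 2 volume) ξ * twoSidedExp (-Complex.I) Complex.I ε x ξ := by
        refine integral_congr_ae ?_
        filter_upwards [fourier_hilbertCLM f] with ξ hξ
        rw [hξ, mul_assoc, mul_left_comm, hilbertMultiplier_mul_twoSidedExp, mul_one, mul_one]
    _ = ∫ t, f t * ((1 / Real.pi : ℂ) * (conjPoissonKernel ε (x - t) : ℂ)) := by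
        rw [integral_fourier_mul _ (integrable_twoSidedExp hε) (memLp_twoSidedExp hε) hQ,
          fourier_twoSidedExp_neg_I_I hε]

theorem truncatedHilbert_eq_poisson_sub (f : Lp ℂ 2 (volume : Measure ℝ)) (hε : 0 < ε) (x : ℝ) :
    truncatedHilbert f x ε = 1 / (Real.pi : ℂ) *
      ((∫ t, hilbertCLM f t * (poissonKernel ε (x - t) : ℂ)) -
        ∫ t, f t * ((conjPoissonKernel ε (x - t) - truncatedKernel ε (x - t) : ℝ) : ℂ)) := by
  have hf := Lp.memLp f
  have hQ := integrable_mul_comp_sub_left hf (memLp_conjPoissonKernel hε) x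
  have hdefect : Integrable fun t =>
      f t * ((conjPoissonKernel ε (x - t) - truncatedKernel ε (x - t) : ℝ) : ℂ) :=
    integrable_mul_comp_sub_left hf ((memLp_conjPoissonKernel hε).sub (memLp_truncatedKernel hε)) x
  rw [truncatedHilbert_eq_integral, integral_hilbertCLM_mul_poissonKernel f hε,
    ← integral_sub hQ hdefect]
  congr 1
  refine integral_congr_ae (Eventually.of_forall fun t => ?_)
  push_cast
  ring

theorem ae_tendsto_truncatedHilbert (f : Lp ℂ 2 (volume : Measure ℝ)) :
    ∀ᵐ x : ℝ, Tendsto (truncatedHilbert f x) (𝓝[>] 0) (𝓝 (hilbertCLM f x)) := by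
  have hf := Lp.memLp f
  have hHf := Lp.memLp (hilbertCLM f)
  filter_upwards [ae_isLebesguePoint (hf.locallyIntegrable one_le_two),
    ae_isLebesguePoint (hHf.locallyIntegrable one_le_two)] with x hx hHx
  have hpoisson : Tendsto (fun ε => ∫ t, hilbertCLM f t * (poissonKernel ε (x - t) : ℂ))
      (𝓝[>] 0) (𝓝 (hilbertCLM f x * Real.pi)) :=
    hHx.tendsto_integral_mul hHf (fun ε => by unfold poissonKernel; fun_prop)
      (fun ε hε s => (abs_of_nonneg (poissonKernel_nonneg hε.le s)).le)
      (fun ε hε => integral_poissonKernel hε)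
  have hdefect := hx.tendsto_integral_mul hf
    (k := fun ε s => conjPoissonKernel ε s - truncatedKernel ε s)
    (fun ε => (by unfold conjPoissonKernel; fun_prop : Measurable (conjPoissonKernel ε)).sub
      (measurable_truncatedKernel ε))
    (fun ε hε => abs_conjPoissonKernel_sub_truncatedKernel_le hε)
    (fun ε _ => integral_conjPoissonKernel_sub_truncatedKernel ε)
  have hlim : 1 / (Real.pi : ℂ) * (hilbertCLM f x * Real.pi - f x * (0 : ℝ)) = hilbertCLM f x := by
    have : (Real.pi : ℂ) ≠ 0 := by simp [Real.pi_ne_zero]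
    field_simp
    simp
  rw [← hlim]
  refine ((hpoisson.sub hdefect).const_mul _).congr' ?_
  filter_upwards [self_mem_nhdsWithin] with ε hε
  exact (truncatedHilbert_eq_poisson_sub f hε x).symm

end HilbertTransform

section Primitives

/-- `F` is an indefinite integral of `f` on `S`: increments of `F` are integrals of `f` along the
segments contained in `S`, which need not be connected. -/
structure IsPrimitiveOn (F f : ℝ → ℂ) (S : Set ℝ) : Prop where
  intervalIntegrable : ∀ ⦃a b : ℝ⦄, uIcc a b ⊆ S → IntervalIntegrable f volume a b
  sub_eq : ∀ ⦃a b : ℝ⦄, uIcc a b ⊆ S → F b - F a = ∫ x in a..b, f x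

variable {F G f g : ℝ → ℂ} {S : Set ℝ} {a b : ℝ}

theorem isPrimitiveOn_of_hasDerivAt (hd : ∀ x ∈ S, HasDerivAt F (f x) x)
    (hc : ContinuousOn f S) : IsPrimitiveOn F f S where
  intervalIntegrable _ _ hab := (hc.mono hab).intervalIntegrable
  sub_eq _ _ hab := (intervalIntegral.integral_eq_sub_of_hasDerivAt (fun x hx => hd x (hab hx))
    (hc.mono hab).intervalIntegrable).symm

theorem isPrimitiveOn_of_contDiff (hF : ContDiff ℝ 1 F) : IsPrimitiveOn F (deriv F) S :=
  isPrimitiveOn_of_hasDerivAt (fun x _ => (hF.differentiable one_ne_zero x).hasDerivAt)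
    (hF.continuous_deriv le_rfl).continuousOn

theorem isPrimitiveOn_integral (hf : LocallyIntegrable f) (c : ℝ) :
    IsPrimitiveOn (fun x => ∫ t in c..x, f t) f S := by
  have hint (a b : ℝ) : IntervalIntegrable f volume a b :=
    intervalIntegrable_iff.2
      ((hf.integrableOn_isCompact isCompact_uIcc).mono_set uIoc_subset_uIcc)
  exact ⟨fun _ _ _ => hint _ _, fun _ _ _ =>
    intervalIntegral.integral_interval_sub_left (hint _ _) (hint _ _)⟩

theorem IsPrimitiveOn.eq_add_integral (h : IsPrimitiveOn F f S) (hab : uIcc a b ⊆ S) :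
    EqOn F (fun x => F a + ∫ t in a..x, f t) (uIcc a b) := fun _ hx =>
  sub_eq_iff_eq_add'.1 (h.sub_eq ((uIcc_subset_uIcc_left hx).trans hab))

theorem IsPrimitiveOn.continuousOn_uIcc (h : IsPrimitiveOn F f S) (hab : uIcc a b ⊆ S) :
    ContinuousOn F (uIcc a b) :=
  (continuousOn_const.add (intervalIntegral.continuousOn_primitive_interval
    ((intervalIntegrable_iff' (by finiteness)).1 (h.intervalIntegrable hab)))).congr
    (h.eq_add_integral hab)

theorem absolutelyContinuousOnInterval_const_add_integral (c : ℂ)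
    (hf : IntervalIntegrable f volume a b) :
    AbsolutelyContinuousOnInterval (fun x => c + ∫ t in a..x, f t) a b := by
  have hnorm := hf.norm.absolutelyContinuousOnInterval_intervalIntegral left_mem_uIcc
  refine squeeze_zero' (Eventually.of_forall fun E => Finset.sum_nonneg fun i _ => dist_nonneg) ?_
    hnorm
  filter_upwards [mem_inf_of_right (mem_principal_self _)] with E hE
  refine Finset.sum_le_sum fun i hi => ?_
  have hmem := hE.1 i hi
  have hsub (x : ℝ) (hx : x ∈ uIcc a b) : IntervalIntegrable f volume a x :=
    hf.mono_set (uIcc_subset_uIcc_left hx)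
  rw [dist_add_left, dist_eq_norm, dist_eq_norm, Real.norm_eq_abs,
    intervalIntegral.integral_interval_sub_left (hsub _ hmem.1) (hsub _ hmem.2),
    intervalIntegral.integral_interval_sub_left (hsub _ hmem.1).norm (hsub _ hmem.2).norm]
  exact intervalIntegral.norm_integral_le_abs_integral_norm

/-- Integration by parts: the difference of the two sides is absolutely continuous with almost
everywhere vanishing derivative. -/
theorem IsPrimitiveOn.mul (hF : IsPrimitiveOn F f S) (hG : IsPrimitiveOn G g S) :
    IsPrimitiveOn (fun x => F x * G x) (fun x => F x * g x + f x * G x) S := by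
  have hint : ∀ ⦃a b : ℝ⦄, uIcc a b ⊆ S →
      IntervalIntegrable (fun x => F x * g x + f x * G x) volume a b := fun a b hab =>
    ((hG.intervalIntegrable hab).continuousOn_mul (hF.continuousOn_uIcc hab)).add
      ((hF.intervalIntegrable hab).mul_continuousOn (hG.continuousOn_uIcc hab))
  refine ⟨hint, fun a b hab => ?_⟩
  have hf := hF.intervalIntegrable hab
  have hg := hG.intervalIntegrable hab
  have hzero : ∀ᵐ x, x ∈ uIcc a b → HasDerivAt
      ((fun x => F a + ∫ t in a..x, f t) • (fun x => G a + ∫ t in a..x, g t) - fun x => (0 : ℂ) +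
        ∫ t in a..x, (F t * g t + f t * G t)) 0 x := by
    filter_upwards [hf.ae_hasDerivAt_integral, hg.ae_hasDerivAt_integral,
      (hint hab).ae_hasDerivAt_integral] with x hfx hgx hx hxab
    refine ((((hfx hxab a left_mem_uIcc).const_add (F a)).mul
      ((hgx hxab a left_mem_uIcc).const_add (G a))).sub
      ((hx hxab a left_mem_uIcc).const_add 0)).congr_deriv ?_
    rw [hF.eq_add_integral hab hxab, hG.eq_add_integral hab hxab]
    ring
  obtain ⟨C, hC⟩ := (((absolutelyContinuousOnInterval_const_add_integral _ hf).smul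
    (absolutelyContinuousOnInterval_const_add_integral _ hg)).sub
    (absolutelyContinuousOnInterval_const_add_integral 0
      (hint hab))).const_of_ae_hasDerivAt_zero hzero
  have hCab := (hC b right_mem_uIcc).trans (hC a left_mem_uIcc).symm
  simp only [Pi.sub_apply, smul_eq_mul, Pi.mul_apply, intervalIntegral.integral_same, zero_add,
    add_zero, sub_zero, ← hF.sub_eq hab, ← hG.sub_eq hab, add_sub_cancel] at hCab
  linear_combination hCab

theorem IsPrimitiveOn.integral_eq_zero (h : IsPrimitiveOn F f univ) (hF : HasCompactSupport F)
    (hf : HasCompactSupport f) : ∫ x, f x = 0 := by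
  obtain ⟨R, hR⟩ := (hF.union hf).isBounded.subset_closedBall 0
  rw [Real.closedBall_eq_Icc, zero_sub, zero_add] at hR
  have hzero (x : ℝ) (hx : x ∉ Ioo (-(R + 1)) (R + 1)) : F x = 0 ∧ f x = 0 := by
    have hx' : x ∉ tsupport F ∪ tsupport f := fun hmem =>
      hx ⟨by linarith [(hR hmem).1], by linarith [(hR hmem).2]⟩
    rw [mem_union, not_or] at hx'
    exact ⟨image_eq_zero_of_notMem_tsupport hx'.1, image_eq_zero_of_notMem_tsupport hx'.2⟩
  have hsupp : Function.support f ⊆ Ioc (-(R + 1)) (R + 1) := fun x hx =>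
    Ioo_subset_Ioc_self (not_imp_comm.1 (hzero x) fun h => hx h.2)
  rw [← intervalIntegral.integral_eq_integral_of_support_subset hsupp,
    ← h.sub_eq (subset_univ _), (hzero _ right_notMem_Ioo).1, (hzero _ left_notMem_Ioo).1, sub_zero]

end Primitives

section DuBoisReymond

variable {U K : Set ℝ}

theorem exists_subset_Icc_subset (hU : U.OrdConnected) (hne : U.Nonempty) (hK : IsCompact K)
    (hKU : K ⊆ U) : ∃ a b, K ⊆ Icc a b ∧ Icc a b ⊆ U := by
  obtain ⟨x₀, hx₀⟩ := hne
  have hK' : insert x₀ K ⊆ U := insert_subset hx₀ hKU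
  obtain ⟨a, ha, hle⟩ := (hK.insert x₀).exists_isLeast (insert_nonempty _ _)
  obtain ⟨b, hb, hge⟩ := (hK.insert x₀).exists_isGreatest (insert_nonempty _ _)
  exact ⟨a, b, fun x hx => ⟨hle (mem_insert_of_mem _ hx), hge (mem_insert_of_mem _ hx)⟩,
    hU.out (hK' ha) (hK' hb)⟩

theorem intervalIntegral_eq_zero_of_notMem_Icc {θ : ℝ → ℂ} {a b x : ℝ}
    (hθ : Function.support θ ⊆ Icc a b) (h0 : ∫ t, θ t = 0) (hx : x ∉ Icc a b) :
    ∫ t in a..x, θ t = 0 := by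
  have hzero {t : ℝ} (ht : t ∉ Icc a b) : θ t = 0 := Function.notMem_support.1 fun h => ht (hθ h)
  rcases lt_or_ge x a with hxa | hax
  · rw [intervalIntegral.integral_symm, intervalIntegral.integral_of_le hxa.le,
      integral_Ioc_eq_integral_Ioo, setIntegral_eq_zero_of_forall_eq_zero, neg_zero]
    exact fun t ht => hzero fun h => h.1.not_gt ht.2
  · have hbx : b < x := not_le.1 fun h => hx ⟨hax, h⟩
    rw [intervalIntegral.integral_of_le hax, ← integral_Icc_eq_integral_Ioc,
      setIntegral_eq_integral_of_forall_compl_eq_zero, h0]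
    exact fun t ht => hzero fun h => ht ⟨h.1, h.2.trans hbx.le⟩

theorem exists_deriv_eq_of_integral_eq_zero (hU : U.OrdConnected) (hne : U.Nonempty) {θ : ℝ → ℂ}
    (hθ : ContDiff ℝ ∞ θ) (hc : HasCompactSupport θ) (hs : tsupport θ ⊆ U) (h0 : ∫ x, θ x = 0) :
    ∃ Θ : ℝ → ℂ, ContDiff ℝ ∞ Θ ∧ HasCompactSupport Θ ∧ tsupport Θ ⊆ U ∧ deriv Θ = θ := by
  obtain ⟨a, b, hab, habU⟩ := exists_subset_Icc_subset hU hne hc.isCompact hs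
  have hderiv (x : ℝ) : HasDerivAt (fun x => ∫ t in a..x, θ t) (θ x) x :=
    hθ.continuous.integral_hasStrictDerivAt a x |>.hasDerivAt
  have hd : deriv (fun x => ∫ t in a..x, θ t) = θ := funext fun x => (hderiv x).deriv
  have hsupp : Function.support (fun x => ∫ t in a..x, θ t) ⊆ Icc a b := fun x hx =>
    not_imp_comm.1 (intervalIntegral_eq_zero_of_notMem_Icc ((subset_tsupport θ).trans hab) h0) hx
  refine ⟨_, contDiff_infty_iff_deriv.2 ⟨fun x => (hderiv x).differentiableAt, by rwa [hd]⟩,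
    HasCompactSupport.of_support_subset_isCompact isCompact_Icc hsupp,
    (closure_minimal hsupp isClosed_Icc).trans habU, hd⟩

theorem exists_contDiff_tsupport_subset_integral_eq_one (hU : IsOpen U) (hne : U.Nonempty) :
    ∃ ψ : ℝ → ℝ, ContDiff ℝ ∞ ψ ∧ HasCompactSupport ψ ∧ tsupport ψ ⊆ U ∧ ∫ x, ψ x = 1 := by
  obtain ⟨x₀, hx₀⟩ := hne
  obtain ⟨ρ, hρ, hρU⟩ := nhds_basis_closedBall.mem_iff.1 (hU.mem_nhds hx₀)
  let β : ContDiffBump x₀ := ⟨ρ / 2, ρ, half_pos hρ, half_lt_self hρ⟩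
  exact ⟨β.normed volume, β.contDiff_normed, β.hasCompactSupport_normed,
    β.tsupport_normed_eq.trans_subset hρU, β.integral_normed⟩

theorem integrable_mul_ofReal_of_hasCompactSupport {f : ℝ → ℂ} (hf : LocallyIntegrable f)
    {k : ℝ → ℝ} (hk : Continuous k) (hkc : HasCompactSupport k) :
    Integrable fun x => f x * k x :=
  (hf.integrable_smul_left_of_hasCompactSupport hk hkc).congr
    (Eventually.of_forall fun x => by simp only [Complex.real_smul, mul_comm])

theorem integral_mul_ofReal_eq_of_forall_integral_mul_deriv_eq_zero (hU : U.OrdConnected)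
    (hne : U.Nonempty) {f : ℝ → ℂ} (hf : LocallyIntegrable f)
    (h : ∀ φ : ℝ → ℂ, ContDiff ℝ ∞ φ → HasCompactSupport φ → tsupport φ ⊆ U →
      ∫ x, f x * deriv φ x = 0) {g ψ : ℝ → ℝ}
    (hg : ContDiff ℝ ∞ g) (hgc : HasCompactSupport g) (hgU : tsupport g ⊆ U)
    (hψ : ContDiff ℝ ∞ ψ) (hψc : HasCompactSupport ψ) (hψU : tsupport ψ ⊆ U)
    (hψ1 : ∫ x, ψ x = 1) :
    ∫ x, f x * g x = (∫ x, g x : ℝ) * ∫ x, f x * ψ x := by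
  set m : ℝ := ∫ x, g x
  have hmean : ∫ x, ((g x - m * ψ x : ℝ) : ℂ) = 0 := by
    rw [integral_complex_ofReal, integral_sub (hg.continuous.integrable_of_hasCompactSupport hgc)
      ((hψ.continuous.integrable_of_hasCompactSupport hψc).const_mul m), integral_const_mul, hψ1,
      mul_one, sub_self, Complex.ofReal_zero]
  have hsupp : Function.support (fun x => ((g x - m * ψ x : ℝ) : ℂ)) ⊆ tsupport g ∪ tsupport ψ := by
    intro x hx
    by_contra hcon
    rw [mem_union, not_or] at hcon
    refine hx ?_
    simp only [image_eq_zero_of_notMem_tsupport hcon.1, image_eq_zero_of_notMem_tsupport hcon.2,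
      mul_zero, sub_zero, Complex.ofReal_zero]
  obtain ⟨Θ, hΘ, hΘc, hΘU, hΘd⟩ := exists_deriv_eq_of_integral_eq_zero hU hne
    (Complex.ofRealCLM.contDiff.comp (hg.sub (contDiff_const.mul hψ)))
    (HasCompactSupport.of_support_subset_isCompact (hgc.isCompact.union hψc.isCompact) hsupp)
    ((closure_minimal hsupp ((isClosed_tsupport g).union (isClosed_tsupport ψ))).trans
      (union_subset hgU hψU)) hmean
  have hΘ0 : ∫ x, (f x * g x - m * (f x * ψ x)) = 0 := by
    rw [← h Θ hΘ hΘc hΘU, hΘd]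
    congr 1 with x
    simp only [Function.comp_apply, Complex.ofRealCLM_apply]
    push_cast
    ring
  rwa [integral_sub (integrable_mul_ofReal_of_hasCompactSupport hf hg.continuous hgc)
    ((integrable_mul_ofReal_of_hasCompactSupport hf hψ.continuous hψc).const_mul _),
    integral_const_mul, sub_eq_zero] at hΘ0

theorem exists_ae_eq_const_of_forall_integral_mul_deriv_eq_zero (hU : IsOpen U)
    (hUc : U.OrdConnected) (hne : U.Nonempty) {f : ℝ → ℂ} (hf : LocallyIntegrable f)
    (h : ∀ φ : ℝ → ℂ, ContDiff ℝ ∞ φ → HasCompactSupport φ → tsupport φ ⊆ U →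
      ∫ x, f x * deriv φ x = 0) :
    ∃ c : ℂ, ∀ᵐ x, x ∈ U → f x = c := by
  obtain ⟨ψ, hψ, hψc, hψU, hψ1⟩ := exists_contDiff_tsupport_subset_integral_eq_one hU hne
  set c : ℂ := ∫ x, f x * ψ x
  have hfc : LocallyIntegrable fun x => f x - c := hf.sub (locallyIntegrable_const c)
  have hae := hU.ae_eq_zero_of_integral_contDiff_smul_eq_zero (hfc.locallyIntegrableOn U)
    fun g hg hgc hgU => by
      have hgi : Integrable fun x => (g x : ℂ) :=
        (hg.continuous.integrable_of_hasCompactSupport hgc).ofReal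
      simp only [Complex.real_smul, mul_sub, mul_comm (Complex.ofReal _) (f _)]
      rw [integral_sub (integrable_mul_ofReal_of_hasCompactSupport hf hg.continuous hgc)
        (hgi.mul_const c), integral_mul_const, integral_complex_ofReal,
        integral_mul_ofReal_eq_of_forall_integral_mul_deriv_eq_zero hUc hne hf h hg hgc hgU hψ hψc
          hψU hψ1, sub_self]
  exact ⟨c, hae.mono fun x hx hxU => sub_eq_zero.1 (hx hxU)⟩

end DuBoisReymond

section Sobolev

variable {U V I : Set ℝ}

theorem memLp_indicator (hU : MeasurableSet U) (v : L2 U) : MemLp (U.indicator v) 2 volume :=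
  (memLp_indicator_iff_restrict hU).2 (Lp.memLp v)

theorem locallyIntegrable_indicator (hU : MeasurableSet U) (v : L2 U) :
    LocallyIntegrable (U.indicator v) :=
  (memLp_indicator hU v).locallyIntegrable one_le_two

theorem integral_indicator_mul (hU : MeasurableSet U) (v φ : ℝ → ℂ) :
    ∫ x, U.indicator v x * φ x = ∫ x in U, v x * φ x := by
  simp only [← integral_indicator hU, indicator_mul_left]

/-- The weak derivative as a bounded operator. -/
def weakDerivCLM (U : Set ℝ) : W12 U →L[ℂ] L2 U :=
  (WithLp.sndL 2 ℂ (L2 U) (L2 U)) ∘L (W12 U).subtypeL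

/-- The inclusion of `W^{1,2}(U)` into `L²(U)` as a bounded operator. -/
def valFnCLM (U : Set ℝ) : W12 U →L[ℂ] L2 U :=
  (WithLp.fstL 2 ℂ (L2 U) (L2 U)) ∘L (W12 U).subtypeL

theorem weakDerivCLM_apply (v : W12 U) : weakDerivCLM U v = weakDeriv v := rfl

theorem valFnCLM_apply (v : W12 U) : valFnCLM U v = valFn v := rfl

theorem integral_valFn_mul_deriv (v : W12 U) {φ : ℝ → ℂ} (hφ : ContDiff ℝ ∞ φ)
    (hc : HasCompactSupport φ) (hs : tsupport φ ⊆ U) :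
    ∫ x in U, valFn v x * deriv φ x = -∫ x in U, weakDeriv v x * φ x := v.2 φ hφ hc hs

theorem weakDeriv_ae_eq_zero (hU : MeasurableSet U) (hV : IsOpen V) (hVU : V ⊆ U) (v : W12 U)
    (h : ∀ᵐ x, x ∈ V → valFn v x = 0) : ∀ᵐ x, x ∈ V → weakDeriv v x = 0 := by
  have hae := hV.ae_eq_zero_of_integral_contDiff_smul_eq_zero
    ((locallyIntegrable_indicator hU (weakDeriv v)).locallyIntegrableOn V) fun g hg hgc hgV => by
      set φ : ℝ → ℂ := fun x => g x
      have hsub : tsupport φ ⊆ tsupport g :=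
        closure_mono fun x hx h0 => hx (by simp only [φ, h0, Complex.ofReal_zero])
      have hφ : ContDiff ℝ ∞ φ := Complex.ofRealCLM.contDiff.comp hg
      have hφc : HasCompactSupport φ := hgc.comp_left Complex.ofReal_zero
      have hparts := integral_valFn_mul_deriv v hφ hφc ((hsub.trans hgV).trans hVU)
      have hzero : ∫ x in U, valFn v x * deriv φ x = 0 := by
        refine integral_eq_zero_of_ae ?_
        filter_upwards [ae_restrict_of_ae h] with x hx
        by_cases hxV : x ∈ V
        · rw [hx hxV, zero_mul, Pi.zero_apply]
        · have hd : deriv φ x = 0 :=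
            Function.notMem_support.1 fun hd => hxV (hgV (hsub (support_deriv_subset hd)))
          rw [hd, mul_zero, Pi.zero_apply]
      rw [hzero, zero_eq_neg, ← integral_indicator_mul hU] at hparts
      simpa only [Complex.real_smul, mul_comm] using hparts
  filter_upwards [hae] with x hx hxV
  rw [← hx hxV, indicator_of_mem (hVU hxV)]

theorem weakDeriv_congr (hU : IsOpen U) {u₁ u₂ : W12 U} (h : valFn u₁ = valFn u₂) :
    weakDeriv u₁ = weakDeriv u₂ := by
  have hzero := weakDeriv_ae_eq_zero hU.measurableSet hU subset_rfl (u₁ - u₂) <| by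
    have hval : valFn (u₁ - u₂) = 0 := sub_eq_zero.2 h
    rw [hval, ← ae_restrict_iff' hU.measurableSet]
    exact Lp.coeFn_zero ℂ 2 (volume.restrict U)
  rw [← sub_eq_zero]
  refine (Lp.eq_zero_iff_ae_eq_zero (f := weakDeriv (u₁ - u₂))).2 ?_
  exact (ae_restrict_iff' hU.measurableSet).2 hzero

theorem exists_W12_of_memLp {F f : ℝ → ℂ} (hF : MemLp F 2 (volume.restrict U))
    (hf : MemLp f 2 (volume.restrict U))
    (h : ∀ φ : ℝ → ℂ, ContDiff ℝ ∞ φ → HasCompactSupport φ → tsupport φ ⊆ U →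
      ∫ x in U, F x * deriv φ x = -∫ x in U, f x * φ x) :
    ∃ u : W12 U, valFn u =ᵐ[volume.restrict U] F ∧ weakDeriv u =ᵐ[volume.restrict U] f := by
  refine ⟨⟨WithLp.toLp 2 (hF.toLp F, hf.toLp f), fun φ hφ hc hs => ?_⟩, hF.coeFn_toLp,
    hf.coeFn_toLp⟩
  have hval : ∫ x in U, hF.toLp F x * deriv φ x = ∫ x in U, F x * deriv φ x :=
    integral_congr_ae (hF.coeFn_toLp.mul (ae_eq_refl _))
  have hder : ∫ x in U, hf.toLp f x * φ x = ∫ x in U, f x * φ x :=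
    integral_congr_ae (hf.coeFn_toLp.mul (ae_eq_refl _))
  exact hval.trans ((h φ hφ hc hs).trans (congrArg _ hder.symm))

theorem exists_W12_mul (v : W12 U) {χ : ℝ → ℂ} (hχ : ContDiff ℝ ∞ χ) {A B : ℝ}
    (hA : ∀ x, ‖χ x‖ ≤ A) (hB : ∀ x, ‖deriv χ x‖ ≤ B) :
    ∃ u : W12 U, valFn u =ᵐ[volume.restrict U] (fun x => χ x * valFn v x) ∧
      weakDeriv u =ᵐ[volume.restrict U] fun x => χ x * weakDeriv v x + deriv χ x * valFn v x := by
  have hχ' : Continuous (deriv χ) := hχ.continuous_deriv (by simp)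
  have hmem {ψ : ℝ → ℂ} {C : ℝ} (hψ : Continuous ψ) (hC : ∀ x, ‖ψ x‖ ≤ C) (f : L2 U) :
      MemLp (fun x => ψ x * f x) 2 (volume.restrict U) :=
    (Lp.memLp f).mul (memLp_top_of_bound hψ.aestronglyMeasurable C (Eventually.of_forall hC))
  refine exists_W12_of_memLp (hmem hχ.continuous hA _)
    ((hmem hχ.continuous hA _).add (hmem hχ' hB _)) fun φ hφ hc hs => ?_
  have hφ' : Continuous (deriv φ) := hφ.continuous_deriv (by simp)
  have hparts := integral_valFn_mul_deriv v (φ := χ * φ) (hχ.mul hφ) hc.mul_left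
    ((tsupport_mul_subset_right (f := χ)).trans hs)
  have hderiv (x : ℝ) : deriv (χ * φ) x = deriv χ x * φ x + χ x * deriv φ x :=
    deriv_mul (hχ.differentiable (by simp)).differentiableAt
      (hφ.differentiable (by simp)).differentiableAt
  have hint₁ : Integrable (fun x => valFn v x * (deriv χ x * φ x)) (volume.restrict U) :=
    integrable_mul_test _ (hχ'.mul hφ.continuous) hc.mul_left
  have hint₂ : Integrable (fun x => valFn v x * (χ x * deriv φ x)) (volume.restrict U) :=
    integrable_mul_test _ (hχ.continuous.mul hφ') hc.deriv.mul_left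
  have hint₃ : Integrable (fun x => weakDeriv v x * (χ x * φ x)) (volume.restrict U) :=
    integrable_mul_test _ (hχ.continuous.mul hφ.continuous) hc.mul_left
  simp_rw [hderiv, Pi.mul_apply, mul_add] at hparts
  rw [integral_add hint₁ hint₂] at hparts
  calc ∫ x in U, χ x * valFn v x * deriv φ x
      = ∫ x in U, valFn v x * (χ x * deriv φ x) := by congr with x; ring
    _ = -((∫ x in U, weakDeriv v x * (χ x * φ x)) + ∫ x in U, valFn v x * (deriv χ x * φ x)) := by
        linear_combination hparts
    _ = -∫ x in U, (χ x * weakDeriv v x + deriv χ x * valFn v x) * φ x := by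
        rw [← integral_add hint₃ hint₁]
        congr with x
        ring

theorem tendsto_W12 {ι : Type*} {l : Filter ι} {u : ι → W12 U} {v : W12 U}
    (h : Tendsto (fun i => valFn (u i)) l (𝓝 (valFn v)))
    (h' : Tendsto (fun i => weakDeriv (u i)) l (𝓝 (weakDeriv v))) : Tendsto u l (𝓝 v) :=
  tendsto_subtype_rng.2 <|
    ((WithLp.prodContinuousLinearEquiv 2 ℂ (L2 U) (L2 U)).symm.continuous.tendsto _).comp
      (h.prodMk_nhds h')

theorem exists_isPrimitiveOn_ae_eq (hU : MeasurableSet U) (hI : IsOpen I) (hIc : I.OrdConnected)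
    (hne : I.Nonempty) (hIU : I ⊆ U) (v : W12 U) :
    ∃ W, IsPrimitiveOn W (U.indicator (weakDeriv v)) univ ∧ ∀ᵐ x, x ∈ I → valFn v x = W x := by
  set g := U.indicator (weakDeriv v)
  have hg : LocallyIntegrable g := locallyIntegrable_indicator hU _
  have hW := isPrimitiveOn_integral (S := univ) hg 0
  have hWc : Continuous fun x => ∫ t in (0 : ℝ)..x, g t :=
    intervalIntegral.continuous_primitive (fun _ _ => hW.intervalIntegrable (subset_univ _)) 0
  obtain ⟨c, hc⟩ := exists_ae_eq_const_of_forall_integral_mul_deriv_eq_zero hI hIc hne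
    ((locallyIntegrable_indicator hU (valFn v)).sub hWc.locallyIntegrable) fun φ hφ hφc hφI => by
      have hd : Continuous (deriv φ) := hφ.continuous_deriv (by simp)
      have hvφ : Integrable fun x => U.indicator (valFn v) x * deriv φ x :=
        (memLp_indicator hU _).integrable_mul (q := 2) (hd.memLp_of_hasCompactSupport hφc.deriv)
      have hWφ : Integrable fun x => (∫ t in (0 : ℝ)..x, g t) * deriv φ x :=
        (hWc.mul hd).integrable_of_hasCompactSupport hφc.deriv.mul_left
      have hgφ : Integrable fun x => g x * φ x :=
        (memLp_indicator hU _).integrable_mul (q := 2)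
          (hφ.continuous.memLp_of_hasCompactSupport hφc)
      have hparts := (hW.mul (isPrimitiveOn_of_contDiff (hφ.of_le (by simp)))).integral_eq_zero
        hφc.mul_left (hφc.deriv.mul_left.add hφc.mul_left)
      rw [integral_add hWφ hgφ, integral_indicator_mul hU, add_eq_zero_iff_eq_neg] at hparts
      simp only [Pi.sub_apply, sub_mul]
      rw [integral_sub hvφ hWφ, integral_indicator_mul hU, hparts,
        integral_valFn_mul_deriv v hφ hφc (hφI.trans hIU), sub_self]
  refine ⟨fun x => c + ∫ t in (0 : ℝ)..x, g t, ⟨hW.intervalIntegrable, fun a b hab => ?_⟩, ?_⟩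
  · rw [add_sub_add_left_eq_sub, hW.sub_eq hab]
  · filter_upwards [hc] with x hx hxI
    rw [← hx hxI, Pi.sub_apply, sub_add_cancel, indicator_of_mem (hIU hxI)]

theorem exists_clm_intervalIntegral_indicator_mul (hU : MeasurableSet U) (a b : ℝ) {k : ℝ → ℂ}
    (hk : Continuous k) :
    ∃ T : L2 U →L[ℂ] ℂ, ∀ v : L2 U, T v = ∫ x in a..b, U.indicator v x * k x := by
  have hkL : MemLp ((uIoc a b).indicator k) 2 (volume.restrict U) := by
    obtain ⟨C, hC⟩ := isCompact_uIcc.exists_bound_of_continuousOn (s := uIcc a b) hk.continuousOn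
    have : IsFiniteMeasure (volume.restrict (uIoc a b)) :=
      inferInstanceAs (IsFiniteMeasure (volume.restrict (Ioc _ _)))
    rw [memLp_indicator_iff_restrict measurableSet_uIoc]
    refine MemLp.mono_measure (Measure.restrict_mono_measure Measure.restrict_le_self _) ?_
    exact MemLp.of_bound hk.aestronglyMeasurable C <| (ae_restrict_iff' measurableSet_uIoc).2 <|
      Eventually.of_forall fun x hx => hC x (uIoc_subset_uIcc hx)
  refine ⟨(if a ≤ b then 1 else -1 : ℝ) • integralMulCLM hkL, fun v => ?_⟩
  rw [intervalIntegral.intervalIntegral_eq_integral_uIoc, smul_apply,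
    integralMulCLM_apply, ← integral_indicator_mul hU, ← integral_indicator measurableSet_uIoc]
  simp only [indicator_mul_right]

end Sobolev

section FreeSurface

theorem mem_freeSurface {x : ℝ} : x ∈ freeSurface ↔ 1 < |x| := Iff.rfl

theorem isOpen_freeSurface : IsOpen freeSurface := isOpen_lt continuous_const continuous_abs

theorem measurableSet_freeSurface : MeasurableSet freeSurface := isOpen_freeSurface.measurableSet

theorem memLp_gExt (v : W12 freeSurface) : MemLp (gExt v) 2 volume :=
  memLp_indicator measurableSet_freeSurface _

theorem Ioi_one_subset_freeSurface : Ioi 1 ⊆ freeSurface := fun _ hx =>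
  mem_freeSurface.2 (lt_abs.2 (Or.inl hx))

theorem Iio_neg_one_subset_freeSurface : Iio (-1) ⊆ freeSurface := fun _ hx =>
  mem_freeSurface.2 (lt_abs.2 (Or.inr (lt_neg.2 hx)))

/-- The closure `{x ∈ ℝ | |x| ≥ 1}` of the free surface, on which the continuous representatives
live. -/
def closedFreeSurface : Set ℝ := {x | 1 ≤ |x|}

theorem mem_closedFreeSurface {x : ℝ} : x ∈ closedFreeSurface ↔ 1 ≤ |x| := Iff.rfl

theorem closedFreeSurface_eq : closedFreeSurface = Ici 1 ∪ Iic (-1) := by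
  ext x
  simp only [mem_closedFreeSurface, le_abs, mem_union, mem_Ici, mem_Iic, le_neg]

theorem Ici_one_subset_closedFreeSurface : Ici 1 ⊆ closedFreeSurface :=
  closedFreeSurface_eq ▸ subset_union_left

theorem Iic_neg_one_subset_closedFreeSurface : Iic (-1) ⊆ closedFreeSurface :=
  closedFreeSurface_eq ▸ subset_union_right

theorem ae_mem_freeSurface_of_mem_closedFreeSurface :
    ∀ᵐ x : ℝ, x ∈ closedFreeSurface → x ∈ freeSurface := by
  filter_upwards [((finite_singleton (1 : ℝ)).insert (-1)).countable.ae_notMem volume]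
    with x hx hx1
  refine mem_freeSurface.2 (lt_of_le_of_ne (mem_closedFreeSurface.1 hx1) fun h => hx ?_)
  rcases (abs_eq zero_le_one).1 h.symm with h | h
  · exact Or.inr h
  · exact Or.inl h

theorem subset_Ici_or_subset_Iic_of_uIcc_subset {a b : ℝ} (hab : uIcc a b ⊆ closedFreeSurface) :
    uIcc a b ⊆ Ici 1 ∨ uIcc a b ⊆ Iic (-1) := by
  rw [closedFreeSurface_eq] at hab
  refine isPreconnected_iff_subset_of_disjoint_closed.1 isPreconnected_uIcc _ _ isClosed_Ici
    isClosed_Iic hab ?_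
  rw [(Ici_disjoint_Iic.2 (by norm_num)).inter_eq, inter_empty]

/-- `w` is the representative of `v ∈ W^{1,2}(ℰ)` that is continuous up to `±1`; it is pinned down
as an indefinite integral of `v'` on the two half-lines `[1, ∞)` and `(-∞, -1]`. -/
structure IsContRep (v : W12 freeSurface) (w : ℝ → ℂ) : Prop where
  ae_eq : ∀ᵐ x ∂(volume.restrict freeSurface), valFn v x = w x
  isPrimitiveOn : IsPrimitiveOn w (gExt v) closedFreeSurface

theorem exists_isContRep (v : W12 freeSurface) : ∃ w, IsContRep v w := by
  obtain ⟨W₁, hW₁, hv₁⟩ := exists_isPrimitiveOn_ae_eq measurableSet_freeSurface isOpen_Ioi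
    ordConnected_Ioi nonempty_Ioi Ioi_one_subset_freeSurface v
  obtain ⟨W₂, hW₂, hv₂⟩ := exists_isPrimitiveOn_ae_eq measurableSet_freeSurface isOpen_Iio
    ordConnected_Iio nonempty_Iio Iio_neg_one_subset_freeSurface v
  have hpos {x : ℝ} (hx : 1 ≤ x) : 0 < x := one_pos.trans_le hx
  have hneg {x : ℝ} (hx : x ≤ -1) : ¬0 < x := by linarith
  refine ⟨fun x => if 0 < x then W₁ x else W₂ x, ?_,
    fun _ _ _ => hW₁.intervalIntegrable (subset_univ _), fun a b hab => ?_⟩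
  · rw [ae_restrict_iff' measurableSet_freeSurface]
    filter_upwards [hv₁, hv₂] with x h₁ h₂ hx
    rcases lt_abs.1 (mem_freeSurface.1 hx) with h | h
    · rw [if_pos (hpos h.le), h₁ h]
    · rw [if_neg (hneg (le_neg_of_le_neg h.le)), h₂ (lt_neg_of_lt_neg h)]
  · rcases subset_Ici_or_subset_Iic_of_uIcc_subset hab with h | h
    · rw [if_pos (hpos (h left_mem_uIcc)), if_pos (hpos (h right_mem_uIcc))]
      exact hW₁.sub_eq (subset_univ _)
    · rw [if_neg (hneg (h left_mem_uIcc)), if_neg (hneg (h right_mem_uIcc))]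
      exact hW₂.sub_eq (subset_univ _)

theorem IsContRep.continuousOn {v : W12 freeSurface} {w : ℝ → ℂ} (h : IsContRep v w) :
    ContinuousOn w closedFreeSurface := by
  have hcont (S : Set ℝ) (hS : S.OrdConnected) (hsub : S ⊆ closedFreeSurface) :
      ContinuousOn w S := by
    rcases S.eq_empty_or_nonempty with rfl | ⟨c, hc⟩
    · exact continuousOn_empty _
    · have hprim : Continuous fun x => ∫ t in c..x, gExt v t :=
        intervalIntegral.continuous_primitive (fun _ _ => (isPrimitiveOn_integral (S := univ)
          ((memLp_gExt v).locallyIntegrable one_le_two) 0).intervalIntegrable (subset_univ _)) c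
      exact (continuous_const.add hprim).continuousOn.congr fun x hx =>
        h.isPrimitiveOn.eq_add_integral ((hS.uIcc_subset hc hx).trans hsub) right_mem_uIcc
  rw [closedFreeSurface_eq]
  exact (hcont _ ordConnected_Ici Ici_one_subset_closedFreeSurface).union_of_isClosed
    (hcont _ ordConnected_Iic Iic_neg_one_subset_closedFreeSurface) isClosed_Ici isClosed_Iic

theorem IsContRep.indicator_ae_eq {v : W12 freeSurface} {w : ℝ → ℂ} (h : IsContRep v w) :
    ∀ᵐ x, x ∈ closedFreeSurface → freeSurface.indicator (valFn v) x = w x := by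
  filter_upwards [(ae_restrict_iff' measurableSet_freeSurface).1 h.ae_eq,
    ae_mem_freeSurface_of_mem_closedFreeSurface] with x hx hmem hxS
  rw [indicator_of_mem (hmem hxS), hx (hmem hxS)]

theorem IsPrimitiveOn.sub_mul_eq_integral {F f : ℝ → ℂ} {S : Set ℝ} {a b : ℝ}
    (h : IsPrimitiveOn F f S) (hab : uIcc a b ⊆ S) :
    ((b - a : ℝ) : ℂ) * F a = ∫ x in a..b, (F x + f x * (x - b : ℝ)) := by
  have hlin : IsPrimitiveOn (fun x : ℝ => ((x - b : ℝ) : ℂ)) (fun _ => 1) S :=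
    isPrimitiveOn_of_hasDerivAt (fun x _ => ((hasDerivAt_id x).sub_const b).ofReal_comp)
      continuousOn_const
  have hparts := (h.mul hlin).sub_eq hab
  simp only [mul_one, sub_self, Complex.ofReal_zero, mul_zero, zero_sub] at hparts
  rw [← hparts, ← neg_sub a b]
  push_cast
  ring

theorem exists_clm_apply_eq_of_isContRep {a b : ℝ} (hab : uIcc a b ⊆ closedFreeSurface)
    (hne : a ≠ b) :
    ∃ T : W12 freeSurface →L[ℂ] ℂ, ∀ v w, IsContRep v w → T v = w a := by
  obtain ⟨A, hA⟩ := exists_clm_intervalIntegral_indicator_mul measurableSet_freeSurface a b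
    (k := fun _ => 1) continuous_const
  obtain ⟨B, hB⟩ := exists_clm_intervalIntegral_indicator_mul measurableSet_freeSurface a b
    (k := fun x => ((x - b : ℝ) : ℂ)) (by fun_prop)
  refine ⟨((b - a : ℝ) : ℂ)⁻¹ • (A ∘L valFnCLM _ + B ∘L weakDerivCLM _), fun v w h => ?_⟩
  have hval : ∫ x in a..b, freeSurface.indicator (valFn v) x * 1 = ∫ x in a..b, w x := by
    refine intervalIntegral.integral_congr_ae ?_
    filter_upwards [h.indicator_ae_eq] with x hx hxab
    rw [hx (hab (uIoc_subset_uIcc hxab)), mul_one]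
  have hw : IntervalIntegrable w volume a b :=
    (h.isPrimitiveOn.continuousOn_uIcc hab).intervalIntegrable
  have hg : IntervalIntegrable (fun x => gExt v x * (x - b : ℝ)) volume a b :=
    (h.isPrimitiveOn.intervalIntegrable hab).mul_continuousOn (by fun_prop)
  rw [smul_apply, add_apply, ContinuousLinearMap.comp_apply, ContinuousLinearMap.comp_apply,
    valFnCLM_apply, weakDerivCLM_apply, hA, hB, hval, ← gExt,
    ← intervalIntegral.integral_add hw hg, smul_eq_mul,
    ← h.isPrimitiveOn.sub_mul_eq_integral hab, inv_mul_cancel_left₀]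
  exact Complex.ofReal_ne_zero.2 (sub_ne_zero.2 hne.symm)

theorem exists_clm_trace_sub : ∃ T : W12 freeSurface →L[ℂ] ℂ,
    ∀ v w, IsContRep v w → T v = w 1 - w (-1) := by
  obtain ⟨A, hA⟩ := exists_clm_apply_eq_of_isContRep (a := 1) (b := 2)
    ((ordConnected_Ici.uIcc_subset le_rfl one_le_two).trans Ici_one_subset_closedFreeSurface)
    (by norm_num)
  obtain ⟨B, hB⟩ := exists_clm_apply_eq_of_isContRep (a := -1) (b := -2)
    ((ordConnected_Iic.uIcc_subset le_rfl (by norm_num)).trans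
      Iic_neg_one_subset_closedFreeSurface) (by norm_num)
  exact ⟨A - B, fun v w h => by rw [sub_apply, hA v w h, hB v w h]⟩

end FreeSurface

section Inversion

variable {F G k : ℝ → ℂ}

theorem ae_ne_zero : ∀ᵐ t : ℝ, t ≠ 0 := (countable_singleton 0).ae_notMem volume

theorem hasDerivWithinAt_one_div (x : ℝ) (hx : x ∈ ({0} : Set ℝ)ᶜ) :
    HasDerivWithinAt (fun x : ℝ => 1 / x) (-(1 / x ^ 2)) {0}ᶜ x := by
  simpa only [one_div] using (hasDerivAt_inv hx).hasDerivWithinAt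

theorem injective_one_div : Function.Injective fun x : ℝ => 1 / x := by
  simpa only [one_div] using inv_injective

theorem image_one_div_compl_zero : (fun x : ℝ => 1 / x) '' {0}ᶜ = {0}ᶜ := by
  ext y
  simp only [mem_image, mem_compl_iff, mem_singleton_iff]
  exact ⟨fun ⟨x, hx, h⟩ => h ▸ one_div_ne_zero hx,
    fun h => ⟨1 / y, one_div_ne_zero h, one_div_one_div y⟩⟩

theorem abs_neg_one_div_sq (t : ℝ) : |-(1 / t ^ 2)| = 1 / t ^ 2 := by
  rw [abs_neg, abs_of_nonneg (by positivity)]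

theorem lintegral_comp_one_div (u : ℝ → ℝ≥0∞) :
    ∫⁻ t : ℝ, ENNReal.ofReal (1 / t ^ 2) * u (1 / t) = ∫⁻ s, u s := by
  have h := lintegral_image_eq_lintegral_abs_deriv_mul (measurableSet_singleton (0 : ℝ)).compl
    hasDerivWithinAt_one_div injective_one_div.injOn u
  simp only [image_one_div_compl_zero, restrict_compl_singleton, abs_neg_one_div_sq] at h
  exact h.symm

theorem integral_comp_one_div (G : ℝ → ℂ) :
    ∫ t : ℝ, 1 / (t : ℂ) ^ 2 * G (1 / t) = ∫ s, G s := by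
  have h := integral_image_eq_integral_abs_deriv_smul (measurableSet_singleton (0 : ℝ)).compl
    hasDerivWithinAt_one_div injective_one_div.injOn G
  simp only [image_one_div_compl_zero, restrict_compl_singleton, abs_neg_one_div_sq,
    Complex.real_smul, Complex.ofReal_div, Complex.ofReal_one, Complex.ofReal_pow] at h
  exact h.symm

theorem integrable_comp_one_div_iff :
    Integrable (fun t : ℝ => 1 / (t : ℂ) ^ 2 * G (1 / t)) ↔ Integrable G := by
  have h := integrableOn_image_iff_integrableOn_abs_deriv_smul
    (measurableSet_singleton (0 : ℝ)).compl hasDerivWithinAt_one_div injective_one_div.injOn G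
  simp only [image_one_div_compl_zero, IntegrableOn, restrict_compl_singleton,
    abs_neg_one_div_sq, Complex.real_smul, Complex.ofReal_div, Complex.ofReal_one,
    Complex.ofReal_pow] at h
  exact h.symm

theorem quasiMeasurePreserving_one_div :
    Measure.QuasiMeasurePreserving (fun x : ℝ => 1 / x) volume volume := by
  refine ⟨by fun_prop, Measure.AbsolutelyContinuous.mk fun s hs h0 => ?_⟩
  have hzero := lintegral_comp_one_div (s.indicator 1)
  have hmeas : Measurable fun t : ℝ => ENNReal.ofReal (1 / t ^ 2) * s.indicator 1 (1 / t) :=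
    Measurable.mul (by fun_prop) ((measurable_one.indicator hs).comp (by fun_prop))
  rw [lintegral_indicator_one hs, h0, lintegral_eq_zero_iff hmeas] at hzero
  rw [Measure.map_apply (by fun_prop) hs, measure_eq_zero_iff_ae_notMem]
  filter_upwards [hzero, ae_ne_zero] with t ht ht0 hts
  rw [indicator_of_mem (mem_preimage.1 hts), Pi.one_apply, mul_one, Pi.zero_apply,
    ENNReal.ofReal_eq_zero] at ht
  exact ht.not_gt (by positivity)

theorem eLpNorm_one_div_mul_comp_one_div (f : ℝ → ℂ) :
    eLpNorm (fun t : ℝ => 1 / (t : ℂ) * f (1 / t)) 2 volume = eLpNorm f 2 volume := by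
  rw [eLpNorm_eq_lintegral_rpow_enorm_toReal two_ne_zero ENNReal.ofNat_ne_top,
    eLpNorm_eq_lintegral_rpow_enorm_toReal two_ne_zero ENNReal.ofNat_ne_top,
    ← lintegral_comp_one_div fun s => ‖f s‖ₑ ^ (2 : ENNReal).toReal]
  congr 2 with t
  rw [enorm_mul, ENNReal.mul_rpow_of_nonneg _ _ ENNReal.toReal_nonneg, ← ofReal_norm, norm_div,
    norm_one, Complex.norm_real, ENNReal.ofReal_rpow_of_nonneg (by positivity) (by simp)]
  simp

theorem memLp_one_div_mul_comp_one_div {f : ℝ → ℂ} (hf : MemLp f 2 volume) :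
    MemLp (fun t : ℝ => 1 / (t : ℂ) * f (1 / t)) 2 volume :=
  ⟨(Measurable.aestronglyMeasurable (by fun_prop)).mul
    (hf.1.comp_quasiMeasurePreserving quasiMeasurePreserving_one_div),
    (eLpNorm_one_div_mul_comp_one_div f).trans_lt hf.2⟩

/-- The derivative of `t ↦ F (1 / t)`, when `G` is the derivative of `F`. -/
def inversionPullback (G : ℝ → ℂ) (t : ℝ) : ℂ := -(1 / (t : ℂ) ^ 2 * G (1 / t))

theorem integral_inversionPullback_mul (G k : ℝ → ℂ) :
    ∫ t, inversionPullback G t * k t = -∫ s, G s * k (1 / s) := by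
  rw [← integral_comp_one_div fun s => G s * k (1 / s), ← integral_neg]
  simp only [inversionPullback, one_div_one_div, neg_mul, mul_assoc]

theorem integral_comp_one_div_mul (F k : ℝ → ℂ) :
    ∫ t, F (1 / t) * k t = ∫ s, F s * (1 / (s : ℂ) ^ 2 * k (1 / s)) := by
  rw [← integral_comp_one_div fun s => F s * (1 / (s : ℂ) ^ 2 * k (1 / s))]
  refine integral_congr_ae ?_
  filter_upwards [ae_ne_zero] with t ht
  have ht' : (t : ℂ) ≠ 0 := Complex.ofReal_ne_zero.2 ht
  rw [one_div_one_div]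
  push_cast
  field_simp

theorem integrable_inversionPullback_mul_iff :
    Integrable (fun t => inversionPullback G t * k t) ↔ Integrable fun s => G s * k (1 / s) := by
  rw [← integrable_comp_one_div_iff (G := fun s => G s * k (1 / s)), ← integrable_neg_iff]
  simp only [inversionPullback, one_div_one_div, neg_mul, mul_assoc, Pi.neg_def, neg_neg]

theorem integrable_comp_one_div_mul_iff :
    Integrable (fun t => F (1 / t) * k t) ↔
      Integrable fun s => F s * (1 / (s : ℂ) ^ 2 * k (1 / s)) := by
  rw [← integrable_comp_one_div_iff (G := fun s => F s * (1 / (s : ℂ) ^ 2 * k (1 / s)))]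
  refine integrable_congr ?_
  filter_upwards [ae_ne_zero] with t ht
  have ht' : (t : ℂ) ≠ 0 := Complex.ofReal_ne_zero.2 ht
  rw [one_div_one_div]
  push_cast
  field_simp

theorem memLp_comp_one_div {f : ℝ → ℂ} (hf : MemLp f 2 volume) (h0 : ∀ t, |t| ≤ 1 → f t = 0) :
    MemLp (fun t => f (1 / t)) 2 volume := by
  have hdiv : MemLp (fun s : ℝ => 1 / (s : ℂ) * f s) 2 volume := by
    refine hf.of_le ((Measurable.aestronglyMeasurable (by fun_prop)).mul hf.1)
      (Eventually.of_forall fun s => ?_)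
    rcases le_or_gt |s| 1 with hs | hs
    · rw [h0 s hs, mul_zero]
    · rw [norm_mul, norm_div, norm_one, Complex.norm_real, Real.norm_eq_abs]
      exact mul_le_of_le_one_left (norm_nonneg _) (div_le_one_of_le₀ hs.le (abs_nonneg s))
  refine (memLp_one_div_mul_comp_one_div hdiv).ae_eq ?_
  filter_upwards [ae_ne_zero] with t ht
  have ht' : (t : ℂ) ≠ 0 := Complex.ofReal_ne_zero.2 ht
  push_cast
  field_simp

theorem memLp_inversionPullback {g : ℝ → ℂ} {R : ℝ} (hg : MemLp g 2 volume)
    (h0 : ∀ᵐ t, R < |t| → g t = 0) : MemLp (inversionPullback g) 2 volume := by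
  have hmul : MemLp (fun s : ℝ => -((s : ℂ) * g s)) 2 volume := by
    refine hg.of_le_mul (c := R) ((Measurable.aestronglyMeasurable (by fun_prop)).mul hg.1).neg ?_
    filter_upwards [h0] with s hs
    rcases lt_or_ge R |s| with h | h
    · rw [hs h, mul_zero, neg_zero, norm_zero, mul_zero]
    · rw [norm_neg, norm_mul, Complex.norm_real, Real.norm_eq_abs]
      gcongr
  refine (memLp_one_div_mul_comp_one_div hmul).ae_eq (Eventually.of_forall fun t => ?_)
  simp only [inversionPullback]
  push_cast
  ring

end Inversion

section TruncatedHilbert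

variable {f g G : ℝ → ℂ} {x δ : ℝ}

theorem truncatedHilbert_congr (h : f =ᵐ[volume] g) : truncatedHilbert f = truncatedHilbert g := by
  funext x ε
  rw [truncatedHilbert_eq_integral, truncatedHilbert_eq_integral]
  congr 1
  refine integral_congr_ae ?_
  filter_upwards [h] with t ht
  rw [ht]

theorem truncatedHilbert_add {ε : ℝ} (hε : 0 < ε) (hf : MemLp f 2) (hg : MemLp g 2) (x : ℝ) :
    truncatedHilbert (f + g) x ε = truncatedHilbert f x ε + truncatedHilbert g x ε := by
  have hk := memLp_truncatedKernel hε
  simp only [truncatedHilbert_eq_integral, Pi.add_apply, add_mul]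
  rw [integral_add (integrable_mul_comp_sub_left hf hk x) (integrable_mul_comp_sub_left hg hk x),
    mul_add]

theorem hilbertTransform_eq_of_tendsto {y : ℂ}
    (h : Tendsto (truncatedHilbert f x) (𝓝[>] 0) (𝓝 y)) : hilbertTransform f x = y :=
  h.limUnder_eq

theorem ae_hilbertExistsAt (hf : MemLp f 2) : ∀ᵐ x, HilbertExistsAt f x := by
  filter_upwards [ae_tendsto_truncatedHilbert (hf.toLp f)] with x hx
  rw [truncatedHilbert_congr hf.coeFn_toLp] at hx
  exact ⟨_, hx⟩

theorem tendsto_truncatedHilbert_of_eq_zero (hδ : 0 < δ) (h : ∀ t, |x - t| < δ → f t = 0) :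
    Tendsto (truncatedHilbert f x) (𝓝[>] 0)
      (𝓝 (1 / (Real.pi : ℂ) * ∫ t, f t / ((x : ℂ) - (t : ℂ)))) := by
  refine tendsto_const_nhds.congr' ?_
  filter_upwards [Ioo_mem_nhdsGT hδ] with ε hε
  rw [truncatedHilbert, setIntegral_eq_integral_of_forall_compl_eq_zero]
  intro t ht
  rw [h t ((not_le.1 ht).trans hε.2), zero_div]

theorem integrable_div_ofReal_sub (hf : Integrable f) (hδ : 0 < δ)
    (h : ∀ t, |x - t| < δ → f t = 0) : Integrable fun t => f t / ((x : ℂ) - (t : ℂ)) := by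
  refine (hf.norm.const_mul δ⁻¹).mono'
    (hf.1.div₀ (Measurable.aestronglyMeasurable (by fun_prop))) (Eventually.of_forall fun t => ?_)
  rw [norm_div, ← Complex.ofReal_sub, Complex.norm_real, Real.norm_eq_abs, div_eq_inv_mul]
  rcases lt_or_ge |x - t| δ with ht | ht
  · rw [h t ht, norm_zero, mul_zero, mul_zero]
  · gcongr

theorem integral_inversionPullback_div (hG : Integrable G) (h0 : ∀ t, |t| ≤ 1 → G t = 0)
    (hx : 1 < |x|) :
    ∫ t, inversionPullback G t / ((x : ℂ) - (t : ℂ)) =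
      1 / (x : ℂ) ^ 2 * (∫ s, G s / (((1 / x : ℝ) : ℂ) - (s : ℂ))) - 1 / (x : ℂ) * ∫ s, G s := by
  have hix : 0 < 1 - |1 / x| := by
    rw [abs_div, abs_one, sub_pos]
    exact (div_lt_one (one_pos.trans hx)).2 hx
  have hker := integrable_div_ofReal_sub (x := 1 / x) hG hix fun t ht => h0 t <| by
    linarith [abs_sub_abs_le_abs_sub t (1 / x), abs_sub_comm t (1 / x)]
  rw [← integral_const_mul, ← integral_const_mul,
    ← integral_sub (hker.const_mul _) (hG.const_mul _), ← integral_comp_one_div fun s =>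
      1 / (x : ℂ) ^ 2 * (G s / (((1 / x : ℝ) : ℂ) - (s : ℂ))) - 1 / (x : ℂ) * G s]
  refine integral_congr_ae ?_
  filter_upwards [ae_ne_zero] with t ht0
  by_cases hGt : G (1 / t) = 0
  · simp only [inversionPullback, hGt, mul_zero, neg_zero, zero_div, sub_zero]
  have ht1 : |t| < 1 := by
    by_contra! hcon
    refine hGt (h0 _ ?_)
    rw [abs_div, abs_one]
    exact div_le_one_of_le₀ hcon (abs_nonneg t)
  have hxC : (x : ℂ) ≠ 0 := Complex.ofReal_ne_zero.2 (abs_pos.1 (one_pos.trans hx))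
  have htC : (t : ℂ) ≠ 0 := Complex.ofReal_ne_zero.2 ht0
  have hxt : (x : ℂ) - t ≠ 0 := sub_ne_zero.2 fun h =>
    (ht1.trans hx).ne' (congrArg _ (Complex.ofReal_injective h))
  have htx : (t : ℂ) - x ≠ 0 := by rwa [← neg_sub, neg_ne_zero]
  have hkernel : ((1 / x : ℝ) : ℂ) - ((1 / t : ℝ) : ℂ) = (t - x) / (x * t) := by
    push_cast
    field_simp
  rw [hkernel, inversionPullback]
  field_simp
  ring

theorem tendsto_truncatedHilbert_inversionPullback (hG : Integrable G)
    (h0 : ∀ t, |t| ≤ 1 → G t = 0) (hx : 1 < |x|) :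
    Tendsto (truncatedHilbert (inversionPullback G) x) (𝓝[>] 0)
      (𝓝 (1 / (x : ℂ) ^ 2 * hilbertTransform G (1 / x)
        - 1 / ((Real.pi : ℂ) * (x : ℂ)) * ∫ s, G s)) := by
  have hx1 : |1 / x| < 1 := by
    rw [abs_div, abs_one]
    exact (div_lt_one (one_pos.trans hx)).2 hx
  have hG0 (t : ℝ) (ht : |1 / x - t| < 1 - |1 / x|) : G t = 0 := h0 t <| by
    linarith [abs_sub_abs_le_abs_sub t (1 / x), abs_sub_comm t (1 / x)]
  have hpull (t : ℝ) (ht : |x - t| < |x| - 1) : inversionPullback G t = 0 := by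
    have ht1 : 1 ≤ |t| := by linarith [abs_sub_abs_le_abs_sub x t]
    rw [inversionPullback, h0, mul_zero, neg_zero]
    rw [abs_div, abs_one]
    exact div_le_one_of_le₀ ht1 (abs_nonneg t)
  have hlim := tendsto_truncatedHilbert_of_eq_zero (sub_pos.2 hx) hpull
  rw [integral_inversionPullback_div hG h0 hx] at hlim
  rw [hilbertTransform_eq_of_tendsto
    (tendsto_truncatedHilbert_of_eq_zero (sub_pos.2 hx1) hG0)]
  convert hlim using 2
  rw [one_div_mul_eq_div, one_div_mul_eq_div]
  ring

end TruncatedHilbert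

section CompactSupport

variable {v : W12 freeSurface} {w : ℝ → ℂ} {R : ℝ}

theorem indicator_freeSurface_eq_zero (f : ℝ → ℂ) {t : ℝ} (ht : |t| ≤ 1) :
    freeSurface.indicator f t = 0 :=
  indicator_of_notMem (fun h => (mem_freeSurface.1 h).not_ge ht) _

theorem MemV0.exists_radius (h : MemV0 v) : ∃ R, 1 < R ∧
    (∀ᵐ x, R < |x| → freeSurface.indicator (valFn v) x = 0) ∧
      ∀ᵐ x, R < |x| → gExt v x = 0 := by
  obtain ⟨K, hK, hv⟩ := h
  obtain ⟨R₀, hR₀, hKR⟩ := hK.isBounded.subset_closedBall_lt 1 0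
  have hsub : {x : ℝ | R₀ < |x|} ⊆ freeSurface := fun x hx => mem_freeSurface.2 (hR₀.trans hx)
  have hval : ∀ᵐ x, x ∈ {x : ℝ | R₀ < |x|} → valFn v x = 0 := by
    filter_upwards [(ae_restrict_iff' measurableSet_freeSurface).1 hv] with x hx hxR
    refine hx (hsub hxR) fun hxK => ?_
    have hle := hKR hxK
    rw [mem_closedBall_zero_iff, Real.norm_eq_abs] at hle
    exact hle.not_gt hxR
  refine ⟨R₀, hR₀, ?_, ?_⟩
  · filter_upwards [hval] with x hx hxR
    rw [indicator_of_mem (hsub hxR), hx hxR]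
  · filter_upwards [weakDeriv_ae_eq_zero measurableSet_freeSurface
      (isOpen_lt continuous_const continuous_abs) hsub v hval] with x hx hxR
    rw [gExt, indicator_of_mem (hsub hxR), hx hxR]

theorem IsContRep.eq_zero_of_lt_abs (hw : IsContRep v w) (hR : 1 < R)
    (hv : ∀ᵐ x, R < |x| → freeSurface.indicator (valFn v) x = 0) {x : ℝ} (hx : R < |x|) :
    w x = 0 := by
  have hopen : IsOpen {x : ℝ | R < |x|} := isOpen_lt continuous_const continuous_abs
  have hsub : {x : ℝ | R < |x|} ⊆ closedFreeSurface := fun x hx =>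
    mem_closedFreeSurface.2 (hR.trans hx).le
  refine Measure.eqOn_open_of_ae_eq (μ := volume) (g := fun _ => 0) ?_ hopen
    (hw.continuousOn.mono hsub) continuousOn_const hx
  rw [EventuallyEq, ae_restrict_iff' hopen.measurableSet]
  filter_upwards [hv, hw.indicator_ae_eq] with x hx hwx hxR
  rw [← hwx (hsub hxR), hx hxR]

theorem IsPrimitiveOn.integral_freeSurface {F f : ℝ → ℂ} (h : IsPrimitiveOn F f closedFreeSurface)
    (hR : 1 < R) (hF : F R = 0) (hF' : F (-R) = 0) (hf : ∀ᵐ x, R < |x| → f x = 0) :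
    ∫ x in freeSurface, f x = F (-1) - F 1 := by
  have hle : -R ≤ -1 := neg_le_neg hR.le
  have hright : uIcc 1 R ⊆ closedFreeSurface :=
    (ordConnected_Ici.uIcc_subset le_rfl hR.le).trans Ici_one_subset_closedFreeSurface
  have hleft : uIcc (-R) (-1) ⊆ closedFreeSurface :=
    (ordConnected_Iic.uIcc_subset hle le_rfl).trans Iic_neg_one_subset_closedFreeSurface
  have hsub : Ioc 1 R ∪ Ico (-R) (-1) ⊆ freeSurface :=
    union_subset (fun x hx => Ioi_one_subset_freeSurface hx.1)
      fun x hx => Iio_neg_one_subset_freeSurface hx.2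
  have hdisj : Disjoint (Ioc 1 R) (Ico (-R) (-1)) :=
    disjoint_left.2 fun x hx hx' => by linarith [hx.1, hx'.2]
  have hzero : ∀ᵐ x, x ∈ freeSurface \ (Ioc 1 R ∪ Ico (-R) (-1)) → f x = 0 := by
    filter_upwards [hf] with x hx hxs
    refine hx (lt_of_not_ge fun hxR => hxs.2 ?_)
    rcases lt_abs.1 (mem_freeSurface.1 hxs.1) with h1 | h1
    · exact Or.inl ⟨h1, (le_abs_self x).trans hxR⟩
    · exact Or.inr ⟨(abs_le.1 hxR).1, lt_neg_of_lt_neg h1⟩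
  have hintL := (intervalIntegrable_iff_integrableOn_Ico_of_le hle (by finiteness)).1
    (h.intervalIntegrable hleft)
  rw [setIntegral_eq_of_subset_of_ae_sdiff_eq_zero measurableSet_freeSurface.nullMeasurableSet
      hsub hzero, setIntegral_union hdisj measurableSet_Ico
      ((intervalIntegrable_iff_integrableOn_Ioc_of_le hR.le).1 (h.intervalIntegrable hright)) hintL,
    integral_Ico_eq_integral_Ioo, ← integral_Ioc_eq_integral_Ioo,
    ← intervalIntegral.integral_of_le hR.le, ← intervalIntegral.integral_of_le hle,
    ← h.sub_eq hright, ← h.sub_eq hleft, hF, hF']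
  ring

theorem IsContRep.integral_mul_deriv_add (hw : IsContRep v w) (hR : 1 < R)
    (hv : ∀ᵐ x, R < |x| → freeSurface.indicator (valFn v) x = 0)
    (hg : ∀ᵐ x, R < |x| → gExt v x = 0) {ψ ψ' : ℝ → ℂ}
    (hψ : ∀ x ∈ closedFreeSurface, HasDerivAt ψ (ψ' x) x)
    (hψ' : ContinuousOn ψ' closedFreeSurface) :
    ∫ x, (freeSurface.indicator (valFn v) x * ψ' x + gExt v x * ψ x) =
      w (-1) * ψ (-1) - w 1 * ψ 1 := by
  have hRR : R < |R + 1| := (lt_add_one R).trans_le (le_abs_self _)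
  have hwz {x : ℝ} (hx : R < |x|) : w x = 0 := hw.eq_zero_of_lt_abs hR hv hx
  have hprim := hw.isPrimitiveOn.mul (isPrimitiveOn_of_hasDerivAt hψ hψ')
  have hGreen := hprim.integral_freeSurface (R := R + 1) (hR.trans (lt_add_one R))
    (by rw [hwz hRR, zero_mul]) (by rw [hwz (by rwa [abs_neg]), zero_mul]) <| by
      filter_upwards [hg] with x hgx hx
      have hxR := (lt_add_one R).trans hx
      rw [hwz hxR, hgx hxR, zero_mul, zero_mul, add_zero]
  rw [← hGreen, ← integral_indicator measurableSet_freeSurface]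
  refine integral_congr_ae ?_
  filter_upwards [hw.indicator_ae_eq] with x hx
  by_cases hxE : x ∈ freeSurface
  · rw [hx (mem_closedFreeSurface.2 (mem_freeSurface.1 hxE).le), indicator_of_mem hxE]
  · rw [indicator_of_notMem hxE, indicator_of_notMem hxE, gExt, indicator_of_notMem hxE,
      zero_mul, zero_mul, add_zero]

theorem IsContRep.integral_gExt (hw : IsContRep v w) (hv : MemV0 v) :
    ∫ x, gExt v x = w (-1) - w 1 := by
  obtain ⟨R, hR, hvR, hgR⟩ := hv.exists_radius
  have h := hw.integral_mul_deriv_add hR hvR hgR (ψ := fun _ => 1) (ψ' := fun _ => 0)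
    (fun x _ => hasDerivAt_const x 1) continuousOn_const
  simpa only [mul_zero, zero_add, mul_one] using h

theorem MemV0.integrable_gExt (hv : MemV0 v) : Integrable (gExt v) := by
  obtain ⟨R, -, -, hg⟩ := hv.exists_radius
  refine (((memLp_gExt v).locallyIntegrable one_le_two).integrableOn_isCompact
    (isCompact_closedBall 0 R)).integrable_of_ae_notMem_eq_zero ?_
  filter_upwards [hg] with x hx hxR
  rw [mem_closedBall_zero_iff, Real.norm_eq_abs, not_le] at hxR
  exact hx hxR

theorem eta_ae_eq (f : ℝ → ℂ) :
    eta f =ᵐ[volume] fun x => freeSurface.indicator f x + freeSurface.indicator f (1 / x) := by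
  have hinv := quasiMeasurePreserving_one_div.ae ae_mem_freeSurface_of_mem_closedFreeSurface
  filter_upwards [hinv, ae_ne_zero] with x hx hx0
  have habs : |1 / x| = 1 / |x| := by rw [abs_div, abs_one]
  by_cases h : 1 < |x|
  · rw [eta, if_pos h, indicator_of_mem (mem_freeSurface.2 h), indicator_freeSurface_eq_zero f
      (habs.trans_le (div_le_one_of_le₀ h.le (abs_nonneg x))), add_zero]
  · have hmem : 1 / x ∈ freeSurface := hx <| mem_closedFreeSurface.2 <| by
      rw [habs]
      exact (one_le_div (abs_pos.2 hx0)).2 (not_lt.1 h)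
    rw [eta, if_neg h, if_neg hx0, indicator_freeSurface_eq_zero f (not_lt.1 h),
      indicator_of_mem hmem, zero_add]

theorem hasDerivAt_sub_comp_one_div {φ φ' : ℝ → ℂ} (hφ : ∀ x, HasDerivAt φ (φ' x) x) {x : ℝ}
    (hx : x ≠ 0) :
    HasDerivAt (fun s => φ s - φ (1 / s)) (φ' x + 1 / (x : ℂ) ^ 2 * φ' (1 / x)) x := by
  have hinv : HasDerivAt (fun s : ℝ => 1 / s) (-(x ^ 2)⁻¹) x := by
    simpa only [one_div] using hasDerivAt_inv hx
  refine ((hφ x).sub ((hφ (1 / x)).scomp x hinv)).congr_deriv ?_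
  rw [Complex.real_smul]
  push_cast
  ring

theorem MemV0.integral_eta_mul_deriv (hv : MemV0 v) {φ : ℝ → ℂ} (hφ : ContDiff ℝ 1 φ)
    (hc : HasCompactSupport φ) :
    ∫ x, (freeSurface.indicator (valFn v) x + freeSurface.indicator (valFn v) (1 / x)) *
        deriv φ x = -∫ x, (gExt v x + inversionPullback (gExt v) x) * φ x := by
  obtain ⟨R, hR, hvR, hgR⟩ := hv.exists_radius
  obtain ⟨w, hw⟩ := exists_isContRep v
  set V := freeSurface.indicator (valFn v)
  have hV : MemLp V 2 volume := memLp_indicator measurableSet_freeSurface _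
  have hVinv : MemLp (fun x => V (1 / x)) 2 volume :=
    memLp_comp_one_div hV fun t ht => indicator_freeSurface_eq_zero _ ht
  have hd : Continuous (deriv φ) := hφ.continuous_deriv le_rfl
  have hφL : MemLp φ 2 volume := hφ.continuous.memLp_of_hasCompactSupport hc
  have hdL : MemLp (deriv φ) 2 volume := hd.memLp_of_hasCompactSupport hc.deriv
  have hVd : Integrable fun x => V x * deriv φ x := hV.integrable_mul hdL
  have hVd' : Integrable fun x => V (1 / x) * deriv φ x := hVinv.integrable_mul hdL
  have hgφ : Integrable fun x => gExt v x * φ x := (memLp_gExt v).integrable_mul hφL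
  have hgφ' : Integrable fun x => inversionPullback (gExt v) x * φ x :=
    (memLp_inversionPullback (memLp_gExt v) hgR).integrable_mul hφL
  have hVs := integrable_comp_one_div_mul_iff.1 hVd'
  have hgs := integrable_inversionPullback_mul_iff.1 hgφ'
  have h0 {x : ℝ} (hx : x ∈ closedFreeSurface) : x ≠ 0 :=
    abs_pos.1 (one_pos.trans_le (mem_closedFreeSurface.1 hx))
  -- After the substitution `s = 1 / x`, the test function for `v` is `φ s - φ (1 / s)`, which
  -- vanishes at `±1`.
  have hparts := hw.integral_mul_deriv_add hR hvR hgR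
    (fun x hx => hasDerivAt_sub_comp_one_div
      (fun y => (hφ.differentiable one_ne_zero y).hasDerivAt) (h0 hx))
    (hd.continuousOn.add ((continuousOn_const.div (by fun_prop) fun x hx =>
      pow_ne_zero 2 (Complex.ofReal_ne_zero.2 (h0 hx))).mul
        (hd.comp_continuousOn (continuousOn_const.div continuousOn_id fun x hx => h0 hx))))
  simp only [div_one, div_neg, sub_self, mul_zero] at hparts
  simp only [add_mul]
  rw [integral_add hVd hVd', integral_add hgφ hgφ', integral_comp_one_div_mul,
    integral_inversionPullback_mul, ← sub_eq_add_neg, ← integral_add hVd hVs,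
    ← integral_sub hgφ hgs, eq_neg_iff_add_eq_zero]
  refine (integral_add (hVd.add hVs) (hgφ.sub hgs)).symm.trans (Eq.trans ?_ hparts)
  simp only [Pi.add_apply, Pi.sub_apply, mul_add, mul_sub, V]

theorem MemV0.exists_eta (hv : MemV0 v) : ∃ u : W12 univ,
    (∀ᵐ x, valFn u x = eta (valFn v) x) ∧
      weakDeriv u =ᵐ[volume] gExt v + inversionPullback (gExt v) := by
  obtain ⟨R, -, -, hgR⟩ := hv.exists_radius
  have hV : MemLp (freeSurface.indicator (valFn v)) 2 volume :=
    memLp_indicator measurableSet_freeSurface _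
  have hVinv := memLp_comp_one_div hV fun t ht => indicator_freeSurface_eq_zero _ ht
  have hgL := (memLp_gExt v).add (memLp_inversionPullback (memLp_gExt v) hgR)
  obtain ⟨u, hu, hu'⟩ := exists_W12_of_memLp ((hV.add hVinv).restrict univ) (hgL.restrict univ)
    fun φ hφ hc _ => by
      rw [setIntegral_univ, setIntegral_univ]
      exact hv.integral_eta_mul_deriv (hφ.of_le (by simp)) hc
  have hall {F G : ℝ → ℂ} (h : F =ᵐ[volume.restrict univ] G) : F =ᵐ[volume] G := by
    rwa [Measure.restrict_univ] at h
  exact ⟨u, (hall hu).trans (eta_ae_eq _).symm, hall hu'⟩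

/-- The right-hand side of the formula for `Λ_Ω v`, where `w` stands for the continuous
representative of `v`. -/
def lambdaOmegaFormula (v : W12 freeSurface) (w : ℝ → ℂ) (x : ℝ) : ℂ :=
  -hilbertTransform (gExt v) x - 1 / (x : ℂ) ^ 2 * hilbertTransform (gExt v) (1 / x)
    - (w 1 - w (-1)) / ((Real.pi : ℂ) * (x : ℂ))

theorem IsContRep.tendsto_truncatedHilbert_weakDeriv (hw : IsContRep v w) (hv : MemV0 v)
    {u : W12 univ} (hu : weakDeriv u =ᵐ[volume] gExt v + inversionPullback (gExt v)) :
    ∀ᵐ x, x ∈ freeSurface →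
      Tendsto (truncatedHilbert (weakDeriv u) x) (𝓝[>] 0) (𝓝 (-lambdaOmegaFormula v w x)) := by
  obtain ⟨R, -, -, hgR⟩ := hv.exists_radius
  have hpull := memLp_inversionPullback (memLp_gExt v) hgR
  filter_upwards [ae_hilbertExistsAt (memLp_gExt v)] with x hx hxE
  have hg : Tendsto (truncatedHilbert (gExt v) x) (𝓝[>] 0) (𝓝 (hilbertTransform (gExt v) x)) :=
    tendsto_nhds_limUnder hx
  have hlim := hg.add <| tendsto_truncatedHilbert_inversionPullback hv.integrable_gExt
    (fun t ht => indicator_freeSurface_eq_zero _ ht) (mem_freeSurface.1 hxE)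
  rw [truncatedHilbert_congr hu]
  refine (hlim.congr' ?_).trans_eq ?_
  · filter_upwards [self_mem_nhdsWithin] with ε hε
    exact (truncatedHilbert_add hε (memLp_gExt v) hpull x).symm
  · rw [hw.integral_gExt hv, lambdaOmegaFormula]
    congr 1
    ring

theorem IsContRep.isLambdaOmega (hw : IsContRep v w) (hv : MemV0 v) {f : L2 freeSurface}
    (hf : f =ᵐ[volume.restrict freeSurface] lambdaOmegaFormula v w) : IsLambdaOmega v f := by
  obtain ⟨u, hu, hu'⟩ := hv.exists_eta
  refine ⟨u, hu, ?_⟩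
  filter_upwards [hf, (ae_restrict_iff' measurableSet_freeSurface).2
    (hw.tendsto_truncatedHilbert_weakDeriv hv hu')] with x hfx hlim
  exact ⟨⟨_, hlim⟩, by rw [hfx, lambdaH, hilbertTransform_eq_of_tendsto hlim, neg_neg]⟩

theorem IsLambdaOmega.unique {f₁ f₂ : L2 freeSurface} (h₁ : IsLambdaOmega v f₁)
    (h₂ : IsLambdaOmega v f₂) : f₁ = f₂ := by
  obtain ⟨u₁, hu₁, hf₁⟩ := h₁
  obtain ⟨u₂, hu₂, hf₂⟩ := h₂
  have hval : valFn u₁ = valFn u₂ := by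
    refine Lp.ext (ae_restrict_of_ae ?_)
    filter_upwards [hu₁, hu₂] with x h₁ h₂
    rw [h₁, h₂]
  refine Lp.ext ?_
  filter_upwards [hf₁, hf₂] with x h₁ h₂
  rw [h₁.2, h₂.2, lambdaH, lambdaH, weakDeriv_congr isOpen_univ hval]

end CompactSupport

section Density

theorem tendsto_Lp_of_dominated {α E : Type*} [MeasurableSpace α] {μ : Measure α}
    [NormedAddCommGroup E] {p : ℝ≥0∞} [Fact (1 ≤ p)] (hp : p ≠ ⊤) {f : ℕ → Lp E p μ}
    {f₀ : Lp E p μ} {g : α → ℝ} (hg : MemLp g p μ) (hb : ∀ n, ∀ᵐ x ∂μ, ‖f n x - f₀ x‖ ≤ g x)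
    (hlim : ∀ᵐ x ∂μ, Tendsto (fun n => f n x) atTop (𝓝 (f₀ x))) :
    Tendsto f atTop (𝓝 f₀) := by
  have hp₀ : p ≠ 0 := (zero_lt_one.trans_le Fact.out).ne'
  have hpos : 0 < p.toReal := ENNReal.toReal_pos hp₀ hp
  have hint : Tendsto (fun n => ∫⁻ x, ‖f n x - f₀ x‖ₑ ^ p.toReal ∂μ) atTop
      (𝓝 (∫⁻ _, 0 ∂μ)) := by
    refine tendsto_lintegral_of_dominated_convergence' (fun x => ‖g x‖ₑ ^ p.toReal)
      (fun n => ((Lp.aestronglyMeasurable (f n)).sub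
        (Lp.aestronglyMeasurable f₀)).enorm.pow_const _) (fun n => ?_)
      (lintegral_rpow_enorm_lt_top_of_eLpNorm_lt_top hp₀ hp hg.2).ne ?_
    · filter_upwards [hb n] with x hx
      gcongr
      exact enorm_le_iff_norm_le.2 (hx.trans (le_abs_self _))
    · filter_upwards [hlim] with x hx
      simpa only [sub_self, enorm_zero, ENNReal.zero_rpow_of_pos hpos] using
        (hx.sub_const (f₀ x)).enorm.ennrpow_const p.toReal
  rw [Lp.tendsto_Lp_iff_tendsto_eLpNorm']
  simp only [eLpNorm_eq_lintegral_rpow_enorm_toReal hp₀ hp, Pi.sub_apply]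
  simpa only [lintegral_zero, ENNReal.zero_rpow_of_pos (one_div_pos.2 hpos)] using
    hint.ennrpow_const (1 / p.toReal)

/-- The smooth cutoff `x ↦ β (x / r)`, where `β` is a bump function equal to `1` on `[-1, 1]` and
supported in `[-2, 2]`. -/
def cutoff (r x : ℝ) : ℂ := (⟨1, 2, one_pos, one_lt_two⟩ : ContDiffBump (0 : ℝ)) (x / r)

theorem contDiff_cutoff (r : ℝ) : ContDiff ℝ ∞ (cutoff r) :=
  Complex.ofRealCLM.contDiff.comp
    ((ContDiffBump.contDiff _).comp (contDiff_id.div_const r))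

theorem norm_cutoff_le_one (r x : ℝ) : ‖cutoff r x‖ ≤ 1 := by
  rw [cutoff, Complex.norm_real, Real.norm_of_nonneg (ContDiffBump.nonneg _)]
  exact ContDiffBump.le_one _

theorem cutoff_eq_one {r x : ℝ} (hr : 0 < r) (hx : |x| ≤ r) : cutoff r x = 1 := by
  rw [cutoff, ContDiffBump.one_of_mem_closedBall, Complex.ofReal_one]
  rw [mem_closedBall_zero_iff, norm_div, Real.norm_eq_abs, Real.norm_of_nonneg hr.le]
  exact div_le_one_of_le₀ hx hr.le

theorem cutoff_eq_zero {r x : ℝ} (hr : 0 < r) (hx : 2 * r ≤ |x|) : cutoff r x = 0 := by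
  rw [cutoff, ContDiffBump.zero_of_le_dist, Complex.ofReal_zero]
  rwa [dist_zero_right, norm_div, Real.norm_eq_abs, Real.norm_of_nonneg hr.le, le_div_iff₀ hr]

theorem cutoff_eq_cutoff_one (r x : ℝ) : cutoff r x = cutoff 1 (r⁻¹ * x) := by
  rw [cutoff, cutoff, div_one, div_eq_inv_mul]

theorem exists_norm_deriv_cutoff_le : ∃ C, ∀ r x, 1 ≤ r → ‖deriv (cutoff r) x‖ ≤ C := by
  have hsupp : HasCompactSupport (cutoff 1) := by
    refine .of_support_subset_isCompact (isCompact_Icc (a := -2) (b := 2)) fun x hx => ?_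
    exact abs_le.1 (le_of_not_ge fun h => hx (cutoff_eq_zero one_pos (by linarith)))
  obtain ⟨C, hC⟩ := hsupp.deriv.exists_bound_of_continuous
    ((contDiff_cutoff 1).continuous_deriv (by simp))
  refine ⟨C, fun r x hr => ?_⟩
  rw [funext (cutoff_eq_cutoff_one r), deriv_comp_mul_left, norm_smul, norm_inv, Real.norm_eq_abs]
  exact (mul_le_of_le_one_left (norm_nonneg _)
    (inv_le_one_of_one_le₀ (hr.trans (le_abs_self r)))).trans (hC _)

theorem eventually_cutoff_eventuallyEq_one (x : ℝ) :
    ∀ᶠ n : ℕ in atTop, cutoff ((n : ℝ) + 1) =ᶠ[𝓝 x] 1 := by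
  filter_upwards [eventually_ge_atTop ⌈|x|⌉₊] with n hn
  have hx : ∀ᶠ y in 𝓝 x, |y| < (n : ℝ) + 1 :=
    continuous_abs.continuousAt.eventually_lt_const ((Nat.ceil_le.1 hn).trans_lt (lt_add_one _))
  exact hx.mono fun y hy => cutoff_eq_one n.cast_add_one_pos hy.le

theorem tendsto_cutoff_mul {U : Set ℝ} {v : W12 U} {u : ℕ → W12 U}
    (hu : ∀ n : ℕ, valFn (u n) =ᵐ[volume.restrict U] fun x => cutoff (n + 1) x * valFn v x)
    (hu' : ∀ n : ℕ, weakDeriv (u n) =ᵐ[volume.restrict U] fun x =>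
      cutoff (n + 1) x * weakDeriv v x + deriv (cutoff (n + 1)) x * valFn v x) :
    Tendsto u atTop (𝓝 v) := by
  obtain ⟨C, hC⟩ := exists_norm_deriv_cutoff_le
  have hsub (n : ℕ) (x : ℝ) (z : ℂ) : ‖cutoff (n + 1) x * z - z‖ ≤ 2 * ‖z‖ := by
    rw [two_mul]
    refine (norm_sub_le _ _).trans (add_le_add_left ?_ _)
    rw [norm_mul]
    exact mul_le_of_le_one_left (norm_nonneg z) (norm_cutoff_le_one _ _)
  have hvN : MemLp (fun x => ‖valFn v x‖) 2 (volume.restrict U) := (Lp.memLp _).norm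
  have hvN' : MemLp (fun x => ‖weakDeriv v x‖) 2 (volume.restrict U) := (Lp.memLp _).norm
  refine tendsto_W12 ?_ ?_
  · refine tendsto_Lp_of_dominated ENNReal.ofNat_ne_top (hvN.const_mul 2) (fun n => ?_) ?_
    · filter_upwards [hu n] with x hx
      rw [hx]
      exact hsub n x _
    · filter_upwards [ae_all_iff.2 hu] with x hx
      refine tendsto_const_nhds.congr' ?_
      filter_upwards [eventually_cutoff_eventuallyEq_one x] with n hn
      rw [hx n, hn.eq_of_nhds, Pi.one_apply, one_mul]
  · refine tendsto_Lp_of_dominated ENNReal.ofNat_ne_top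
      ((hvN'.const_mul 2).add (hvN.const_mul C)) (fun n => ?_) ?_
    · filter_upwards [hu' n] with x hx
      rw [hx, add_sub_right_comm]
      refine (norm_add_le _ _).trans (add_le_add (hsub n x _) ?_)
      rw [norm_mul]
      exact mul_le_mul_of_nonneg_right (hC _ _ (le_add_of_nonneg_left n.cast_nonneg))
        (norm_nonneg _)
    · filter_upwards [ae_all_iff.2 hu'] with x hx
      refine tendsto_const_nhds.congr' ?_
      filter_upwards [eventually_cutoff_eventuallyEq_one x] with n hn
      have hderiv : deriv (cutoff (n + 1)) x = 0 := by
        rw [hn.deriv_eq, Pi.one_def, deriv_const]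
      rw [hx n, hn.eq_of_nhds, hderiv, Pi.one_apply, one_mul, zero_mul, add_zero]

theorem exists_seq_memV0_tendsto (v : W12 freeSurface) :
    ∃ u : ℕ → W12 freeSurface, (∀ n, MemV0 (u n)) ∧ Tendsto u atTop (𝓝 v) := by
  obtain ⟨C, hC⟩ := exists_norm_deriv_cutoff_le
  choose u hu hu' using fun n : ℕ => exists_W12_mul v (contDiff_cutoff (n + 1))
    (norm_cutoff_le_one _) fun x => hC _ x (le_add_of_nonneg_left n.cast_nonneg)
  refine ⟨u, fun n => ⟨closedBall 0 (2 * (n + 1)), isCompact_closedBall _ _, ?_⟩,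
    tendsto_cutoff_mul hu hu'⟩
  filter_upwards [hu n] with x hx hxK
  rw [mem_closedBall_zero_iff, not_le, Real.norm_eq_abs] at hxK
  rw [hx, cutoff_eq_zero n.cast_add_one_pos hxK.le, zero_mul]

end Density

section Operators

theorem exists_clm_of_eLpNorm_le {α β 𝕜 E F : Type*} [MeasurableSpace α] [MeasurableSpace β]
    {μ : Measure α} {ν : Measure β} [NontriviallyNormedField 𝕜] [NormedAddCommGroup E]
    [NormedSpace 𝕜 E] [NormedAddCommGroup F] [NormedSpace 𝕜 F] {p q : ℝ≥0∞} [Fact (1 ≤ p)]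
    [Fact (1 ≤ q)] {T : Lp E p μ → β → F} {C : NNReal} (hm : ∀ f, AEStronglyMeasurable (T f) ν)
    (hC : ∀ f, eLpNorm (T f) q ν ≤ C * eLpNorm f p μ)
    (hadd : ∀ f g, T (f + g) =ᵐ[ν] T f + T g) (hsmul : ∀ (c : 𝕜) f, T (c • f) =ᵐ[ν] c • T f) :
    ∃ S : Lp E p μ →L[𝕜] Lp F q ν, ∀ f, S f =ᵐ[ν] T f := by
  have hlt (f : Lp E p μ) : C * eLpNorm f p μ < ⊤ :=
    ENNReal.mul_lt_top ENNReal.coe_lt_top (Lp.eLpNorm_lt_top f)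
  have hT (f : Lp E p μ) : MemLp (T f) q ν := ⟨hm f, (hC f).trans_lt (hlt f)⟩
  let S : Lp E p μ →ₗ[𝕜] Lp F q ν :=
    { toFun := fun f => (hT f).toLp (T f)
      map_add' := fun f g => by
        rw [← MemLp.toLp_add]
        exact (MemLp.toLp_eq_toLp_iff _ _).2 (hadd f g)
      map_smul' := fun c f => by
        rw [RingHom.id_apply, ← MemLp.toLp_const_smul]
        exact (MemLp.toLp_eq_toLp_iff _ _).2 (hsmul c f) }
  refine ⟨S.mkContinuous C fun f => ?_, fun f => (hT f).coeFn_toLp⟩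
  change ‖(hT f).toLp (T f)‖ ≤ C * ‖f‖
  rw [Lp.norm_toLp, Lp.norm_def, ← ENNReal.coe_toReal, ← ENNReal.toReal_mul]
  exact ENNReal.toReal_mono (hlt f).ne (hC f)

theorem exists_clm_indicator {U : Set ℝ} (hU : MeasurableSet U) :
    ∃ X : L2 U →L[ℂ] Lp ℂ 2 (volume : Measure ℝ), ∀ f, X f =ᵐ[volume] U.indicator f := by
  have hae {f g : ℝ → ℂ} (h : f =ᵐ[volume.restrict U] g) :
      U.indicator f =ᵐ[volume] U.indicator g := (ae_eq_restrict_iff_indicator_ae_eq hU).1 h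
  refine exists_clm_of_eLpNorm_le (C := 1) (T := fun f => U.indicator f)
    (fun f => (memLp_indicator hU f).1) (fun f => ?_) (fun f g => ?_) fun c f => ?_
  · rw [ENNReal.coe_one, one_mul, eLpNorm_indicator_eq_eLpNorm_restrict hU]
  · rw [← indicator_add']
    exact hae (Lp.coeFn_add f g)
  · exact (hae (Lp.coeFn_smul c f)).trans (EventuallyEq.of_eq (indicator_const_smul U c f))

theorem exists_clm_inversionPullback :
    ∃ J : Lp ℂ 2 (volume : Measure ℝ) →L[ℂ] L2 freeSurface,
      ∀ f, J f =ᵐ[volume.restrict freeSurface] inversionPullback f := by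
  refine exists_clm_of_eLpNorm_le (C := 1) (T := fun f => inversionPullback f) (fun f => ?_)
    (fun f => ?_) (fun f g => ae_restrict_of_ae ?_) fun c f => ae_restrict_of_ae ?_
  · exact ((Measurable.aestronglyMeasurable (by fun_prop)).mul
      ((Lp.aestronglyMeasurable f).comp_quasiMeasurePreserving
        quasiMeasurePreserving_one_div)).neg.restrict
  · rw [ENNReal.coe_one, one_mul, ← eLpNorm_one_div_mul_comp_one_div f]
    refine (eLpNorm_mono_ae ?_).trans (eLpNorm_restrict_le _ _ _ freeSurface)
    filter_upwards [ae_restrict_mem measurableSet_freeSurface] with x hx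
    have hx1 : 1 ≤ |x| := (mem_freeSurface.1 hx).le
    rw [inversionPullback, norm_neg, norm_mul, norm_mul, norm_div, norm_div, norm_pow,
      Complex.norm_real, norm_one, Real.norm_eq_abs]
    gcongr
    exact le_self_pow₀ hx1 two_ne_zero
  · filter_upwards [quasiMeasurePreserving_one_div.ae (Lp.coeFn_add f g)] with x hx
    simp only [inversionPullback, Pi.add_apply, hx]
    ring
  · filter_upwards [quasiMeasurePreserving_one_div.ae (Lp.coeFn_smul c f)] with x hx
    simp only [inversionPullback, Pi.smul_apply, smul_eq_mul, hx]
    ring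

theorem memLp_one_div_pi_mul : MemLp (fun x : ℝ => 1 / ((Real.pi : ℂ) * (x : ℂ))) 2
    (volume.restrict freeSurface) := by
  have hker := ((memLp_truncatedKernel one_pos).ofReal (K := ℂ)).const_mul (1 / (Real.pi : ℂ))
  refine (hker.restrict freeSurface).ae_eq ?_
  filter_upwards [ae_restrict_mem measurableSet_freeSurface] with x hx
  rw [truncatedKernel, if_pos (mem_freeSurface.1 hx).le]
  push_cast
  exact one_div_mul_one_div _ _

theorem exists_lambdaOmega : ∃ Λ : W12 freeSurface →L[ℂ] L2 freeSurface,
    ∀ v w, IsContRep v w → Λ v =ᵐ[volume.restrict freeSurface] lambdaOmegaFormula v w := by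
  obtain ⟨X, hX⟩ := exists_clm_indicator measurableSet_freeSurface
  obtain ⟨J, hJ⟩ := exists_clm_inversionPullback
  obtain ⟨T, hT⟩ := exists_clm_trace_sub
  set R := LpToLpRestrictCLM ℝ ℂ ℂ volume 2 freeSurface
  set k : L2 freeSurface := memLp_one_div_pi_mul.toLp _
  refine ⟨(J - R) ∘L hilbertCLM ∘L X ∘L weakDerivCLM freeSurface - T.smulRight k,
    fun v w hw => ?_⟩
  set G := hilbertCLM (X (weakDeriv v))
  have hG : ∀ᵐ x, G x = hilbertTransform (gExt v) x := by
    filter_upwards [ae_tendsto_truncatedHilbert (X (weakDeriv v))] with x hx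
    rw [truncatedHilbert_congr (hX (weakDeriv v))] at hx
    exact (hilbertTransform_eq_of_tendsto hx).symm
  change ⇑(J G - R G - T v • k) =ᵐ[_] _
  rw [hT v w hw]
  filter_upwards [Lp.coeFn_sub (J G - R G) ((w 1 - w (-1)) • k), Lp.coeFn_sub (J G) (R G), hJ G,
    LpToLpRestrictCLM_coeFn ℂ freeSurface G, Lp.coeFn_smul (w 1 - w (-1)) k,
    memLp_one_div_pi_mul.coeFn_toLp, ae_restrict_of_ae hG,
    ae_restrict_of_ae (quasiMeasurePreserving_one_div.ae hG)]
    with x hsub hJR hJx hRx hk hkx hGx hGx'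
  rw [hsub, Pi.sub_apply, hJR, Pi.sub_apply, hJx, hRx, hk, Pi.smul_apply, hkx, inversionPullback,
    hGx, hGx', lambdaOmegaFormula, smul_eq_mul]
  ring

end Operators

end FloatingDisk

end

theorem mainTheorem4 :
    ∃ Λ : W12 freeSurface →L[ℂ] L2 freeSurface,
      -- `Λ` extends `Λ_Ω` from `V₀(ℰ)`, and is the only bounded operator that does
      (∀ v : W12 freeSurface, MemV0 v → IsLambdaOmega v (Λ v)) ∧
      (∀ Λ' : W12 freeSurface →L[ℂ] L2 freeSurface,
        (∀ v : W12 freeSurface, MemV0 v → IsLambdaOmega v (Λ' v)) → Λ' = Λ) ∧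
      -- the formula; `w` is the representative of `v` that is continuous up to `±1`
      ∀ v : W12 freeSurface, ∃ w : ℝ → ℂ,
        ContinuousOn w {x : ℝ | 1 ≤ |x|} ∧
        (∀ᵐ x ∂(volume.restrict freeSurface), valFn v x = w x) ∧
        ∀ᵐ x ∂(volume.restrict freeSurface),
          HilbertExistsAt (gExt v) x ∧ HilbertExistsAt (gExt v) (1 / x) ∧
          Λ v x = - hilbertTransform (gExt v) x
            - (1 / (x : ℂ) ^ 2) * hilbertTransform (gExt v) (1 / x)
            - (w 1 - w (-1)) / ((Real.pi : ℂ) * (x : ℂ)) := by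
  obtain ⟨Λ, hΛ⟩ := exists_lambdaOmega
  have hext (v : W12 freeSurface) (hv : MemV0 v) : IsLambdaOmega v (Λ v) := by
    obtain ⟨w, hw⟩ := exists_isContRep v
    exact hw.isLambdaOmega hv (hΛ v w hw)
  refine ⟨Λ, hext, fun Λ' hΛ' => ?_, fun v => ?_⟩
  · ext1 v
    obtain ⟨u, hu, hlim⟩ := exists_seq_memV0_tendsto v
    refine tendsto_nhds_unique ((Λ'.continuous.tendsto v).comp hlim) ?_
    refine ((Λ.continuous.tendsto v).comp hlim).congr fun n => ?_
    exact (hext _ (hu n)).unique (hΛ' _ (hu n))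
  · obtain ⟨w, hw⟩ := exists_isContRep v
    have hex := ae_hilbertExistsAt (memLp_gExt v)
    refine ⟨w, hw.continuousOn, hw.ae_eq, ?_⟩
    filter_upwards [hΛ v w hw, ae_restrict_of_ae hex,
      ae_restrict_of_ae (quasiMeasurePreserving_one_div.ae hex)] with x hform hx hxinv
    exact ⟨hx, hxinv, hform⟩
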